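/- Fix an integer $\ell>0$ and $\mathbf k\in(\mathbb N\cup\{\infty\})^{\ell}$. For $\mathbf n\in\mathbb N^\ell$ let $|\mathbf n|$ be the sum of its entries, and order vectors coordinatewise. A vector composition is a finite (possibly empty) sequence $I=(\mathbf i_1,\dots,\mathbf i_m)$ of nonzero vectors in $\mathbb N^\ell$; its columns are the $\mathbf i_r$. Let $\mathrm{QSym}^{(\ell)}$ be the $\mathbb N^\ell$-graded space over $\mathbb Q$ of quasisymmetric functions of level $\ell$: power series of finite degree in commuting variables $x^{(i)}_j$ ($0\le i<\ell$, $j\ge1$), with $\mathbf x_j^{\mathbf n}=\prod_i (x^{(i)}_j)^{n_i}$, in which $\mathbf x_1^{\mathbf i_1}\cdots\mathbf x_m^{\mathbf i_m}$ and $\mathbf x_{j_1}^{\mathbf i_1}\cdots\mathbf x_{j_m}^{\mathbf i_m}$ have equal coefficients for every vector composition $(\mathbf i_1,\dots,\mathbf i_m)$ and all $j_1<\cdots<j_m$. It has the basis $M_I=\sum_{j_1<\cdots<j_m}\mathbf x_{j_1}^{\mathbf i_1}\cdots\mathbf x_{j_m}^{\mathbf i_m}$, the coproduct $\Delta(M_I)=\sum_{I=JK}M_J\otimes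 M_K$ (sum over deconcatenations), and the universal character $\zeta$, with $\zeta(M_I)=1$ if $I$ has at most one column and $\zeta(M_I)=0$ otherwise. Put $\bar\zeta(h)=(-1)^{|\mathbf n|}\zeta(h)$ for $h$ homogeneous of multidegree $\mathbf n$, and let $\zeta_{\mathbf n},\bar\zeta_{\mathbf n}$ denote the components in degree $\mathbf n$, as elements of the graded dual of $\mathrm{QSym}^{(\ell)}$ (an algebra under convolution). For a color word $u=u_1\cdots u_n\in\{0,\dots,\ell-1\}^n$ put $\mathbf F_{12\cdots n,u}=\sum_{j_1\le\cdots\le j_n}(j_1,u_1)(j_2,u_2)\cdots(j_n,u_n)$, a noncommutative power series over $\mathbb Q$ in the letters $(j,i)$, $j\ge 1$, $0\le i<\ell$. Let $\mathrm{NSym}^{(\ell)}$ be the algebra of noncommutative symmetric functions of level $\ell$, i.e. the algebra generated by the complete functions $S_{\mathbf n}=\sum_u \mathbf F_{12\cdots|\mathbf n|,u}$, where $u$ runs over the color words of length $|\mathbf n|$ in which each color $i$ occurs $n_i$ times. Put $S^I=S_{\mathbf i_1}\cdots S_{\mathbf i_m}$. There is exactly one algebra isomorphism from $\mathrm{NSym}^{(\ell)}$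 to the graded dual of $\mathrm{QSym}^{(\ell)}$ with $S^I(M_J)=\delta_{I,J}$ for all vector compositions $I,J$, and by it the two algebras are identified. Let $\mathcal{IE}^{\mathbf k}\subseteq\mathrm{NSym}^{(\ell)}$, the $\mathbf k$-even Hopf ideal, be the two-sided ideal generated by the $\bar\zeta_{\mathbf n}-\zeta_{\mathbf n}$ with $\mathbf n\le\mathbf k$, and let $\mathcal E^{\mathbf k}\subseteq\mathrm{QSym}^{(\ell)}$, the $\mathbf k$-even Hopf algebra, be the largest graded subcoalgebra $C$ of $\mathrm{QSym}^{(\ell)}$ such that $\bar\zeta(h)=\zeta(h)$ for all $h\in C\cap\bigoplus_{\mathbf n\le\mathbf k}\mathrm{QSym}^{(\ell)}_{\mathbf n}$. Then $\mathcal{IE}^{\mathbf k}$ is the two-sided ideal of $\mathrm{NSym}^{(\ell)}$ generated by the $S_{\mathbf n}$ with $\mathbf 0<\mathbf n\le\mathbf k$ and $|\mathbf n|$ odd. Dually, $$\mathcal E^{\mathbf k}=\mathrm{span}_{\mathbb Q}\{M_{(\mathbf i_1,\dots,\mathbf i_m)}\mid \text{for every } r,\ \mathbf i_r\le\mathbf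 k\text{ implies that }|\mathbf i_r|\text{ is even}\}.$$ -/

import Mathlib

open scoped TensorProduct

/-! ### Multipartite numbers and vector compositions -/

/-- The weight `|n|` of an `l`-partite number `n ∈ ℕ^l`. -/
def pweight {l : ℕ} (n : Fin l → ℕ) : ℕ := ∑ i, n i

/-- `n ≤ k` coordinatewise, for `n ∈ ℕ^l` and `k ∈ (ℕ ∪ {∞})^l`. -/
def PLe {l : ℕ} (n : Fin l → ℕ) (k : Fin l → ℕ∞) : Prop := ∀ i, (n i : ℕ∞) ≤ k i

/-- Vector compositions: finite sequences of nonzero `l`-partite numbers (the columns). -/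
def VComp (l : ℕ) : Type := {I : List (Fin l → ℕ) // ∀ c ∈ I, c ≠ 0}

namespace VComp

variable {l : ℕ}

noncomputable instance : DecidableEq (VComp l) := Classical.decEq _

/-- The list of columns. -/
def cols (I : VComp l) : List (Fin l → ℕ) := I.1

/-- The number of columns. -/
def len (I : VComp l) : ℕ := I.cols.length

/-- The `r`-th column (numbered from `0`). -/
def col (I : VComp l) (r : Fin I.len) : Fin l → ℕ := I.cols.get r

/-- The sum of the columns. -/
def total (I : VComp l) : Fin l → ℕ := I.cols.sum

/-- The first `r` columns. -/
def take (r : ℕ) (I : VComp l) : VComp l :=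
  ⟨I.1.take r, fun c hc => I.2 c (List.mem_of_mem_take hc)⟩

/-- All columns but the first `r`. -/
def drop (r : ℕ) (I : VComp l) : VComp l :=
  ⟨I.1.drop r, fun c hc => I.2 c (List.mem_of_mem_drop hc)⟩

theorem ext {I J : VComp l} (h : I.cols = J.cols) : I = J := Subtype.ext h

end VComp

/-- Summing over the ways to cut a sequence of length `N` into three consecutive pieces. -/
theorem sum_cut_cut {A : Type*} [AddCommMonoid A] (N : ℕ) (f : ℕ → ℕ → A) :
    ∑ r ∈ Finset.range (N + 1), ∑ s ∈ Finset.range (r + 1), f s r =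
      ∑ s ∈ Finset.range (N + 1), ∑ t ∈ Finset.range (N - s + 1), f s (s + t) := by
  rw [Finset.sum_sigma', Finset.sum_sigma']
  refine Finset.sum_bij' (fun x _ => ⟨x.2, x.1 - x.2⟩) (fun x _ => ⟨x.1 + x.2, x.1⟩) ?_ ?_ ?_ ?_ ?_
  · rintro ⟨r, s⟩ h; simp at h ⊢; omega
  · rintro ⟨r, s⟩ h; simp at h ⊢; omega
  · rintro ⟨r, s⟩ h; simp at h ⊢; omega
  · rintro ⟨r, s⟩ h; simp at h ⊢
  · rintro ⟨r, s⟩ h; simp at h ⊢; congr 1; omega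

/-! ### Canonical subcoalgebras and ideals of a multigraded coalgebra -/

section Graded

variable {l : ℕ} {H : Type*} [AddCommGroup H] [Module ℚ H] [Coalgebra ℚ H]

/-- `ℕ^l`-graded coalgebras: the counit lives in degree `0`, and
`Δ(H_n) ⊆ ⨁_{i + j = n} H_i ⊗ H_j`. -/
class GradedCoalg (𝒜 : (Fin l → ℕ) → Submodule ℚ H) : Prop where
  counit_eq_zero : ∀ n, n ≠ 0 → ∀ x ∈ 𝒜 n, Coalgebra.counit (R := ℚ) x = 0
  comul_mem : ∀ n, ∀ x ∈ 𝒜 n, Coalgebra.comul (R := ℚ) x ∈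
    ⨆ p : {p : (Fin l → ℕ) × (Fin l → ℕ) // p.1 + p.2 = n},
      LinearMap.range (TensorProduct.map (𝒜 p.1.1).subtype (𝒜 p.1.2).subtype)

/-- The (multi)graded dual of `H`: the linear functionals that vanish on all but finitely many
graded pieces, as a subalgebra of the dual with the convolution product. -/
def gradedDual (𝒜 : (Fin l → ℕ) → Submodule ℚ H) [GradedCoalg 𝒜] :
    Subalgebra ℚ (WithConv (H →ₗ[ℚ] ℚ)) where
  carrier := {f | ∃ s : Finset (Fin l → ℕ), ∀ n, n ∉ s → ∀ x ∈ 𝒜 n, f.ofConv x = 0}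
  add_mem' := by
    classical
    rintro f g ⟨s, hs⟩ ⟨t, ht⟩
    refine ⟨s ∪ t, fun n hn x hx => ?_⟩
    simp only [Finset.mem_union, not_or] at hn
    simp [hs n hn.1 x hx, ht n hn.2 x hx]
  mul_mem' := by
    classical
    rintro f g ⟨s, hs⟩ ⟨t, ht⟩
    refine ⟨(s ×ˢ t).image (fun p => p.1 + p.2), fun n hn x hx => ?_⟩
    have key : (⨆ p : {p : (Fin l → ℕ) × (Fin l → ℕ) // p.1 + p.2 = n},
        LinearMap.range (TensorProduct.map (𝒜 p.1.1).subtype (𝒜 p.1.2).subtype)) ≤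
        LinearMap.ker (LinearMap.mul' ℚ ℚ ∘ₗ TensorProduct.map f.ofConv g.ofConv) := by
      refine iSup_le ?_
      rintro ⟨⟨a, b⟩, hab⟩
      rw [LinearMap.range_le_ker_iff]
      ext ⟨y, hy⟩ ⟨z, hz⟩
      by_cases ha : a ∈ s
      · by_cases hb : b ∈ t
        · exact absurd (Finset.mem_image.2 ⟨(a, b), Finset.mem_product.2 ⟨ha, hb⟩, hab⟩) hn
        · simp [ht b hb z hz]
      · simp [hs a ha y hy]
    exact key (GradedCoalg.comul_mem n x hx)
  algebraMap_mem' := by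
    intro r
    refine ⟨{0}, fun n hn x hx => ?_⟩
    have := GradedCoalg.counit_eq_zero (𝒜 := 𝒜) n (by simpa using hn) x hx
    change (algebraMap ℚ (WithConv (H →ₗ[ℚ] ℚ)) r) x = 0
    rw [LinearMap.convAlgebraMap_apply, this]
    simp

variable (𝒜 : (Fin l → ℕ) → Submodule ℚ H) [DirectSum.Decomposition 𝒜]

/-- The projection of `H` onto its graded piece of degree `n`. -/
noncomputable def gproj (n : Fin l → ℕ) : H →ₗ[ℚ] H :=
  (𝒜 n).subtype ∘ₗ DirectSum.component ℚ (Fin l → ℕ) (fun n => 𝒜 n) n ∘ₗ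
    (DirectSum.decomposeLinearEquiv 𝒜).toLinearMap

/-- The functional `φ̄`, with `φ̄(h) = (-1)^{|n|} φ(h)` for `h ∈ H_n`. -/
noncomputable def bar (φ : H →ₗ[ℚ] ℚ) : H →ₗ[ℚ] ℚ :=
  DirectSum.toModule ℚ (Fin l → ℕ) ℚ
      (fun n => ((-1 : ℚ) ^ pweight n) • (φ ∘ₗ (𝒜 n).subtype)) ∘ₗ
    (DirectSum.decomposeLinearEquiv 𝒜).toLinearMap

/-- The homogeneous component `φ_n` of a functional `φ`, an element of the graded dual: it is `φ`
on `H_n` and `0` on the other graded pieces. -/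
noncomputable def dualComponent [GradedCoalg 𝒜] (φ : H →ₗ[ℚ] ℚ) (n : Fin l → ℕ) :
    gradedDual 𝒜 :=
  ⟨WithConv.toConv (φ ∘ₗ gproj 𝒜 n), {n}, fun m hm x hx => by
    have h : (DirectSum.decompose 𝒜 x n : H) = 0 :=
      DirectSum.decompose_of_mem_ne 𝒜 hx (by simpa using hm)
    change φ (DirectSum.decompose 𝒜 x n : H) = 0
    rw [h, map_zero]⟩

/-- The (two-sided) ideal of the graded dual generated by the `φ_n - ψ_n` with `n ≤ k`. -/
noncomputable def canonicalIdeal [GradedCoalg 𝒜] (φ ψ : H →ₗ[ℚ] ℚ) (k : Fin l → ℕ∞) :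
    TwoSidedIdeal (gradedDual 𝒜) :=
  TwoSidedIdeal.span
    {x | ∃ n : Fin l → ℕ, PLe n k ∧ x = dualComponent 𝒜 φ n - dualComponent 𝒜 ψ n}

/-- The `k`-even ideal of `(H, φ)`. -/
noncomputable def evenIdeal [GradedCoalg 𝒜] (φ : H →ₗ[ℚ] ℚ) (k : Fin l → ℕ∞) :
    TwoSidedIdeal (gradedDual 𝒜) :=
  canonicalIdeal 𝒜 (bar 𝒜 φ) φ k

/-- `C` is a subcoalgebra: `Δ(C) ⊆ C ⊗ C`. -/
def IsSubcoalg (C : Submodule ℚ H) : Prop :=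
  ∀ x ∈ C, Coalgebra.comul (R := ℚ) x ∈ LinearMap.range (TensorProduct.map C.subtype C.subtype)

/-- The graded subcoalgebras `C` such that `φ` and `ψ` agree on `C ∩ ⨁_{n ≤ k} H_n`. -/
def agreeingSubcoalgs (φ ψ : H →ₗ[ℚ] ℚ) (k : Fin l → ℕ∞) : Set (Submodule ℚ H) :=
  {C | DirectSum.SetLike.IsHomogeneous 𝒜 C ∧ IsSubcoalg C ∧
    ∀ h ∈ C, h ∈ (⨆ n : {n : Fin l → ℕ // PLe n k}, 𝒜 n) → φ h = ψ h}

/-- The largest graded subcoalgebra of `H` such that `φ` and `ψ` agree on its intersection with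
`⨁_{n ≤ k} H_n`. -/
def canonicalSub (φ ψ : H →ₗ[ℚ] ℚ) (k : Fin l → ℕ∞) : Submodule ℚ H :=
  sSup (agreeingSubcoalgs 𝒜 φ ψ k)

/-- The `k`-even subalgebra of `(H, φ)`. -/
noncomputable def evenSub (φ : H →ₗ[ℚ] ℚ) (k : Fin l → ℕ∞) : Submodule ℚ H :=
  canonicalSub 𝒜 (bar 𝒜 φ) φ k

/-- The largest such subcoalgebra exists. -/
theorem canonicalSub_isGreatest (φ ψ : H →ₗ[ℚ] ℚ) (k : Fin l → ℕ∞) :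
    IsGreatest (agreeingSubcoalgs 𝒜 φ ψ k) (canonicalSub 𝒜 φ ψ k) := by
  classical
  refine ⟨⟨?_, ?_, ?_⟩, fun C hC => le_sSup hC⟩
  · intro n
    have : canonicalSub 𝒜 φ ψ k ≤ (canonicalSub 𝒜 φ ψ k).comap (gproj 𝒜 n) :=
      sSup_le fun C hC x hx =>
        (le_sSup hC : C ≤ canonicalSub 𝒜 φ ψ k) (hC.1 n hx)
    exact fun m hm => this hm
  · have : canonicalSub 𝒜 φ ψ k ≤
        (LinearMap.range (TensorProduct.map (canonicalSub 𝒜 φ ψ k).subtype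
          (canonicalSub 𝒜 φ ψ k).subtype)).comap (Coalgebra.comul (R := ℚ)) := by
      refine sSup_le fun C hC x hx => ?_
      have hle : C ≤ canonicalSub 𝒜 φ ψ k := le_sSup hC
      obtain ⟨y, hy⟩ := hC.2.1 x hx
      refine ⟨TensorProduct.map (Submodule.inclusion hle) (Submodule.inclusion hle) y, ?_⟩
      rw [← hy, ← LinearMap.comp_apply, ← TensorProduct.map_comp]
      rfl
    exact fun m hm => this hm
  · have h1 : ∀ n, PLe n k → ∀ x ∈ canonicalSub 𝒜 φ ψ k,
        φ (gproj 𝒜 n x) = ψ (gproj 𝒜 n x) := by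
      intro n hn x hx
      have : canonicalSub 𝒜 φ ψ k ≤
          LinearMap.ker (φ ∘ₗ gproj 𝒜 n - ψ ∘ₗ gproj 𝒜 n) := by
        refine sSup_le fun C hC x hx => ?_
        rw [LinearMap.mem_ker, LinearMap.sub_apply, sub_eq_zero]
        refine hC.2.2 _ (hC.1 n hx) ?_
        exact Submodule.mem_iSup_of_mem (⟨n, hn⟩ : {n : Fin l → ℕ // PLe n k})
          (DirectSum.decompose 𝒜 x n).2
      have := this hx
      rwa [LinearMap.mem_ker, LinearMap.sub_apply, sub_eq_zero] at this
    intro h hh hk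
    have h2 : ∀ n, ¬ PLe n k → gproj 𝒜 n h = 0 := by
      intro n hn
      have : (⨆ n : {n : Fin l → ℕ // PLe n k}, 𝒜 n) ≤ LinearMap.ker (gproj 𝒜 n) := by
        refine iSup_le fun m x hx => ?_
        exact DirectSum.decompose_of_mem_ne 𝒜 hx (fun e => hn (e ▸ m.2))
      exact this hk
    rw [← DirectSum.sum_support_decompose 𝒜 h, map_sum, map_sum]
    refine Finset.sum_congr rfl fun n _ => ?_
    by_cases hn : PLe n k
    · exact h1 n hn h hh
    · have : (DirectSum.decompose 𝒜 h n : H) = 0 := h2 n hn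
      rw [this, map_zero, map_zero]

end Graded

/-! ### Quasisymmetric functions of level `l` -/

section QSymDef

variable {l : ℕ}

/-- The exponent of the monomial `x_{j_1}^{c_1} ⋯ x_{j_m}^{c_m}`, where
`x_j^c = (x_j^{(0)})^{c_0} ⋯ (x_j^{(l-1)})^{c_{l-1}}`. The variable `x_j^{(i)}` is `(j, i)`; the
positions `j` of the variables are numbered from `0`. -/
noncomputable def colMono {m : ℕ} (j : Fin m → ℕ) (c : Fin m → Fin l → ℕ) : (ℕ × Fin l) →₀ ℕ :=
  ∑ r, ∑ i, Finsupp.single (j r, i) (c r i)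

/-- The exponent of `x_{j_1}^{i_1} ⋯ x_{j_m}^{i_m}` for a vector composition `(i_1, …, i_m)`. -/
noncomputable def VComp.mono (I : VComp l) (j : Fin I.len → ℕ) : (ℕ × Fin l) →₀ ℕ :=
  colMono j I.col

/-- The multidegree of a monomial. -/
def mdeg (e : (ℕ × Fin l) →₀ ℕ) : Fin l → ℕ := e.sum fun x a => Pi.single x.2 a

/-- Power series of finite degree in which `x_1^{i_1} ⋯ x_m^{i_m}` and
`x_{j_1}^{i_1} ⋯ x_{j_m}^{i_m}` have the same coefficient whenever `j_1 < ⋯ < j_m` and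
`(i_1, …, i_m)` is a vector composition. -/
def IsQuasisymmetric (f : MvPowerSeries (ℕ × Fin l) ℚ) : Prop :=
  (∃ d : ℕ, ∀ e, MvPowerSeries.coeff e f ≠ 0 → e.degree ≤ d) ∧
  ∀ (I : VComp l) (j : Fin I.len → ℕ), StrictMono j →
    MvPowerSeries.coeff (I.mono j) f = MvPowerSeries.coeff (I.mono Fin.val) f

theorem colMono_apply {m : ℕ} {j : Fin m → ℕ} (hj : Function.Injective j)
    (c : Fin m → Fin l → ℕ) (r : Fin m) (i : Fin l) : colMono j c (j r, i) = c r i := by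
  classical
  simp only [colMono, Finsupp.finsetSum_apply, Finsupp.single_apply, Prod.mk.injEq]
  rw [Finset.sum_eq_single r, Finset.sum_eq_single i]
  · simp
  · intro b _ hb; simp [hb]
  · simp
  · intro b _ hb; simp [hj.ne hb]
  · simp

theorem colMono_apply_of_notMem {m : ℕ} {j : Fin m → ℕ} (c : Fin m → Fin l → ℕ) {p : ℕ}
    (hp : ∀ r, j r ≠ p) (i : Fin l) : colMono j c (p, i) = 0 := by
  classical
  simp [colMono, Finsupp.finsetSum_apply, hp]

theorem colMono_comp {m : ℕ} (j : Fin m → ℕ) (c : Fin m → Fin l → ℕ) (s : ℕ → ℕ) :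
    colMono (s ∘ j) c = Finsupp.mapDomain (Prod.map s id) (colMono j c) := by
  simp only [colMono, Finsupp.mapDomain_finsetSum, Finsupp.mapDomain_single, Prod.map_apply,
    Function.comp_apply, id_eq]

theorem VComp.exists_mono (e : (ℕ × Fin l) →₀ ℕ) :
    ∃ (I : VComp l) (j : Fin I.len → ℕ), StrictMono j ∧ I.mono j = e := by
  classical
  let s : Finset ℕ := e.support.image Prod.fst
  let j : Fin s.card → ℕ := s.orderEmbOfFin rfl
  let c : Fin s.card → Fin l → ℕ := fun r i => e (j r, i)
  have hj : StrictMono j := (s.orderEmbOfFin rfl).strictMono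
  have hc : ∀ r, c r ≠ 0 := by
    intro r h
    have : j r ∈ s := Finset.orderEmbOfFin_mem s rfl r
    obtain ⟨⟨p, i⟩, hx, hx'⟩ := Finset.mem_image.1 this
    have h1 : c r i = 0 := congrFun h i
    simp only at hx'
    simp only [c, ← hx'] at h1
    exact Finsupp.mem_support_iff.1 hx h1
  have he : colMono j c = e := by
    ext ⟨p, i⟩
    by_cases hp : p ∈ s
    · have : p ∈ Set.range j := by
        have := Finset.range_orderEmbOfFin s (k := s.card) rfl
        rw [show Set.range j = _ from this]; exact hp
      obtain ⟨r, rfl⟩ := this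
      exact colMono_apply hj.injective c r i
    · rw [colMono_apply_of_notMem]
      · by_contra h
        exact hp (Finset.mem_image.2 ⟨(p, i), Finsupp.mem_support_iff.2 (Ne.symm h), rfl⟩)
      · rintro r rfl
        exact hp (Finset.orderEmbOfFin_mem s rfl r)
  have hlen : (List.ofFn c).length = s.card := List.length_ofFn
  refine ⟨⟨List.ofFn c, ?_⟩, fun r => j (Fin.cast hlen r), ?_, ?_⟩
  · intro v hv
    obtain ⟨r, rfl⟩ := (List.mem_ofFn' _ _).1 hv
    exact hc r
  · exact fun a b h => hj h
  · rw [← he]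
    unfold VComp.mono colMono
    refine Fintype.sum_equiv (finCongr hlen) _ _ fun r => ?_
    refine Finset.sum_congr rfl fun i _ => ?_
    simp [VComp.col, VComp.cols, finCongr]
    rfl

theorem VComp.mono_inj {I J : VComp l} {j : Fin I.len → ℕ} {j' : Fin J.len → ℕ}
    (hj : StrictMono j) (hj' : StrictMono j') (h : I.mono j = J.mono j') :
    I = J ∧ HEq j j' := by
  have hmem : ∀ (K : VComp l) (q : Fin K.len → ℕ), StrictMono q → ∀ p,
      p ∈ Set.range q ↔ ∃ i, K.mono q (p, i) ≠ 0 := by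
    intro K q hq p
    constructor
    · rintro ⟨r, rfl⟩
      have := K.2 (K.col r) (List.get_mem _ _)
      obtain ⟨i, hi⟩ := Function.ne_iff.1 this
      exact ⟨i, by rw [VComp.mono, colMono_apply hq.injective]; exact hi⟩
    · rintro ⟨i, hi⟩
      by_contra hp
      exact hi (colMono_apply_of_notMem _ (fun r hr => hp ⟨r, hr⟩) i)
  have hr : Set.range j = Set.range j' := by
    ext p; rw [hmem I j hj, hmem J j' hj', h]
  have hlen : I.len = J.len := by
    have h1 := Set.ncard_range_of_injective hj.injective
    have h2 := Set.ncard_range_of_injective hj'.injective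
    rw [hr, h2] at h1
    simpa using h1.symm
  have hjj : ∀ r, j r = j' (Fin.cast hlen r) := by
    have : j = j' ∘ Fin.cast hlen := by
      refine (StrictMono.range_inj hj (hj'.comp fun a b h => h)).1 ?_
      rw [hr]
      exact ((finCongr hlen).surjective.range_comp j').symm
    exact congrFun this
  have hcols : I = J := by
    refine VComp.ext (List.ext_get hlen fun n h1 h2 => ?_)
    ext i
    have e1 := colMono_apply hj.injective I.col ⟨n, h1⟩ i
    have e2 := colMono_apply hj'.injective J.col ⟨n, h2⟩ i
    have e3 : j ⟨n, h1⟩ = j' ⟨n, h2⟩ := hjj ⟨n, h1⟩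
    refine e1.symm.trans (Eq.trans ?_ e2)
    rw [← e3]
    exact DFunLike.congr_fun h _
  subst hcols
  exact ⟨rfl, heq_of_eq (funext hjj)⟩

/-- A strictly increasing sequence extends to all of `ℕ`. -/
theorem exists_strictMono_extend {m : ℕ} (j : Fin m → ℕ) (hj : StrictMono j) :
    ∃ s : ℕ → ℕ, StrictMono s ∧ ∀ r : Fin m, s r.val = j r := by
  refine ⟨fun n => if h : n < m then j ⟨n, h⟩ else n + ∑ r, j r, ?_, ?_⟩
  · intro a b hab
    dsimp only
    split_ifs with h1 h2 h2
    · exact hj hab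
    · have := Finset.single_le_sum (f := j) (fun _ _ => Nat.zero_le _)
        (Finset.mem_univ (⟨a, h1⟩ : Fin m))
      omega
    · omega
    · omega
  · intro r; simp

/-- Quasisymmetry as invariance under all increasing relabellings of the positions. -/
theorem quasisymmetric_iff (f : MvPowerSeries (ℕ × Fin l) ℚ) :
    (∀ (I : VComp l) (j : Fin I.len → ℕ), StrictMono j →
      MvPowerSeries.coeff (I.mono j) f = MvPowerSeries.coeff (I.mono Fin.val) f) ↔
    ∀ (s : ℕ → ℕ), StrictMono s → ∀ e,
      MvPowerSeries.coeff (Finsupp.mapDomain (Prod.map s id) e) f = MvPowerSeries.coeff e f := by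
  constructor
  · intro h s hs e
    obtain ⟨I, j, hj, rfl⟩ := VComp.exists_mono e
    rw [VComp.mono, ← colMono_comp]
    exact (h I _ (hs.comp hj)).trans (h I j hj).symm
  · intro h I j hj
    obtain ⟨s, hs, hsj⟩ := exists_strictMono_extend j hj
    have : j = s ∘ Fin.val := funext fun r => (hsj r).symm
    rw [this, VComp.mono, colMono_comp]
    exact h s hs _

theorem quasisymmetric_mul {f g : MvPowerSeries (ℕ × Fin l) ℚ} (hf : IsQuasisymmetric f)
    (hg : IsQuasisymmetric g) : IsQuasisymmetric (f * g) := by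
  classical
  obtain ⟨⟨d, hd⟩, hf⟩ := hf
  obtain ⟨⟨d', hd'⟩, hg⟩ := hg
  refine ⟨⟨d + d', fun e he => ?_⟩, ?_⟩
  · rw [MvPowerSeries.coeff_mul] at he
    obtain ⟨⟨a, b⟩, hab, h⟩ := Finset.exists_ne_zero_of_sum_ne_zero he
    have h1 := hd a (left_ne_zero_of_mul h)
    have h2 := hd' b (right_ne_zero_of_mul h)
    rw [Finset.HasAntidiagonal.mem_antidiagonal] at hab
    simp only at hab
    rw [← hab, map_add]
    omega
  · rw [quasisymmetric_iff] at hf hg ⊢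
    intro s hs e
    rw [MvPowerSeries.coeff_mul, MvPowerSeries.coeff_mul]
    have hinj : Function.Injective (Prod.map s (id : Fin l → Fin l)) :=
      hs.injective.prodMap Function.injective_id
    symm
    refine Finset.sum_bij (fun p _ => (Finsupp.mapDomain (Prod.map s id) p.1,
      Finsupp.mapDomain (Prod.map s id) p.2)) ?_ ?_ ?_ ?_
    · rintro ⟨a, b⟩ h
      rw [Finset.HasAntidiagonal.mem_antidiagonal] at h ⊢
      simp only at h ⊢
      rw [← Finsupp.mapDomain_add, h]
    · rintro ⟨a, b⟩ _ ⟨a', b'⟩ _ h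
      simp only [Prod.mk.injEq] at h
      exact Prod.ext (Finsupp.mapDomain_injective hinj h.1) (Finsupp.mapDomain_injective hinj h.2)
    · rintro ⟨a, b⟩ h
      rw [Finset.HasAntidiagonal.mem_antidiagonal] at h
      simp only at h
      have hsupp : ∀ x ∉ Set.range (Prod.map s (id : Fin l → Fin l)), a x = 0 ∧ b x = 0 := by
        intro x hx
        have h0 := DFunLike.congr_fun h x
        rw [Finsupp.mapDomain_of_notMem_range _ _ hx] at h0
        simpa using h0
      have key : ∀ c : (ℕ × Fin l) →₀ ℕ,
          (∀ x ∉ Set.range (Prod.map s (id : Fin l → Fin l)), c x = 0) →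
          Finsupp.mapDomain (Prod.map s id) (c.comapDomain (Prod.map s id) hinj.injOn) = c := by
        intro c hc
        refine Finsupp.mapDomain_comapDomain _ hinj c ?_
        intro x hx
        by_contra hx'
        exact Finsupp.mem_support_iff.1 hx (hc x hx')
      have ha := key a fun x hx => (hsupp x hx).1
      have hb := key b fun x hx => (hsupp x hx).2
      refine ⟨(a.comapDomain _ hinj.injOn, b.comapDomain _ hinj.injOn), ?_, ?_⟩
      · rw [Finset.HasAntidiagonal.mem_antidiagonal]
        apply Finsupp.mapDomain_injective hinj
        rw [Finsupp.mapDomain_add]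
        simp only
        rw [ha, hb, h]
      · simp only
        rw [ha, hb]
    · rintro ⟨a, b⟩ _
      simp only
      rw [hf s hs, hg s hs]

/-- The algebra of quasisymmetric functions of level `l`. -/
def QSym (l : ℕ) : Subalgebra ℚ (MvPowerSeries (ℕ × Fin l) ℚ) where
  carrier := {f | IsQuasisymmetric f}
  mul_mem' := quasisymmetric_mul
  add_mem' := by
    rintro f g ⟨⟨d, hd⟩, hf⟩ ⟨⟨d', hd'⟩, hg⟩
    refine ⟨⟨d + d', fun e he => ?_⟩, fun I j hj => ?_⟩
    · by_contra h
      have h1 : MvPowerSeries.coeff e f = 0 := by by_contra h1; have := hd e h1; omega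
      have h2 : MvPowerSeries.coeff e g = 0 := by by_contra h2; have := hd' e h2; omega
      exact he (by rw [map_add, h1, h2, add_zero])
    · rw [map_add, map_add, hf I j hj, hg I j hj]
  algebraMap_mem' := by
    classical
    intro r
    have hc : ∀ e, MvPowerSeries.coeff e (algebraMap ℚ (MvPowerSeries (ℕ × Fin l) ℚ) r) =
        if e = 0 then r else 0 := fun e => by
      rw [MvPowerSeries.algebraMap_apply, MvPowerSeries.coeff_C]; rfl
    refine ⟨⟨0, fun e he => ?_⟩, (quasisymmetric_iff _).2 fun s hs e => ?_⟩
    · rw [hc] at he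
      have : e = 0 := by by_contra h; exact he (if_neg h)
      simp [this]
    · have hinj : Function.Injective (Prod.map s (id : Fin l → Fin l)) :=
        hs.injective.prodMap Function.injective_id
      have : Finsupp.mapDomain (Prod.map s id) e = 0 ↔ e = 0 :=
        ⟨fun h => Finsupp.mapDomain_injective hinj (h.trans Finsupp.mapDomain_zero.symm),
          fun h => by rw [h, Finsupp.mapDomain_zero]⟩
      rw [hc, hc]; simp only [this]

end QSymDef

namespace QSym

variable {l : ℕ}

open Classical in
/-- The power series `∑_{j_1 < ⋯ < j_m} x_{j_1}^{i_1} ⋯ x_{j_m}^{i_m}`: the coefficient of a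
monomial is the number of ways in which it occurs in this sum. -/
noncomputable def monomialSeries (I : VComp l) : MvPowerSeries (ℕ × Fin l) ℚ :=
  fun e => (Nat.card {j : Fin I.len → ℕ // StrictMono j ∧ I.mono j = e} : ℚ)

open Classical in
theorem coeff_monomialSeries (I J : VComp l) (j : Fin J.len → ℕ) (hj : StrictMono j) :
    MvPowerSeries.coeff (J.mono j) (monomialSeries I) = if I = J then 1 else 0 := by
  change (Nat.card {j' : Fin I.len → ℕ // StrictMono j' ∧ I.mono j' = J.mono j} : ℚ) = _
  split_ifs with h
  · subst h
    have : Unique {j' : Fin I.len → ℕ // StrictMono j' ∧ I.mono j' = I.mono j} :=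
      ⟨⟨⟨j, hj, rfl⟩⟩, fun j' => Subtype.ext
        (eq_of_heq (VComp.mono_inj j'.2.1 hj j'.2.2).2)⟩
    rw [Nat.card_unique, Nat.cast_one]
  · have : IsEmpty {j' : Fin I.len → ℕ // StrictMono j' ∧ I.mono j' = J.mono j} :=
      ⟨fun j' => h (VComp.mono_inj j'.2.1 hj j'.2.2).1⟩
    rw [Nat.card_of_isEmpty, Nat.cast_zero]

theorem val_strictMono (m : ℕ) : StrictMono (Fin.val : Fin m → ℕ) := fun _ _ h => h

theorem degree_mono (I : VComp l) (j : Fin I.len → ℕ) :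
    (I.mono j).degree = ∑ r, pweight (I.col r) := by
  simp [VComp.mono, colMono, pweight, map_sum, Finsupp.degree_single]

theorem isQuasisymmetric_monomialSeries (I : VComp l) : IsQuasisymmetric (monomialSeries I) := by
  classical
  refine ⟨⟨∑ r, pweight (I.col r), fun e he => ?_⟩, fun J j hj => ?_⟩
  · obtain ⟨J, j, hj, rfl⟩ := VComp.exists_mono e
    rw [coeff_monomialSeries I J j hj] at he
    have : I = J := by by_contra h; exact he (if_neg h)
    subst this
    exact (degree_mono I j).le
  · rw [coeff_monomialSeries I J j hj, coeff_monomialSeries I J _ (val_strictMono _)]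

/-- The monomial quasisymmetric function `M_I`. -/
noncomputable def M (I : VComp l) : QSym l := ⟨monomialSeries I, isQuasisymmetric_monomialSeries I⟩

/-- The coefficient of `x_1^{i_1} ⋯ x_m^{i_m}`. -/
noncomputable def vcoeff (I : VComp l) : QSym l →ₗ[ℚ] ℚ :=
  MvPowerSeries.coeff (I.mono Fin.val) ∘ₗ (QSym l).val.toLinearMap

open Classical in
theorem vcoeff_M (I J : VComp l) : vcoeff J (M I) = if I = J then 1 else 0 :=
  coeff_monomialSeries I J _ (val_strictMono _)

theorem ext_vcoeff {f g : QSym l} (h : ∀ I, vcoeff I f = vcoeff I g) : f = g := by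
  refine Subtype.ext (MvPowerSeries.ext fun e => ?_)
  obtain ⟨I, j, hj, rfl⟩ := VComp.exists_mono e
  rw [f.2.2 I j hj, g.2.2 I j hj]
  exact h I

theorem pweight_pos {n : Fin l → ℕ} (h : n ≠ 0) : 0 < pweight n := by
  obtain ⟨i, hi⟩ := Function.ne_iff.1 h
  exact Finset.sum_pos' (fun _ _ => Nat.zero_le _) ⟨i, Finset.mem_univ i, Nat.pos_of_ne_zero hi⟩

theorem finite_bounded (d : ℕ) : {I : VComp l | ∑ r, pweight (I.col r) ≤ d}.Finite := by
  classical
  refine Set.Finite.of_finite_image (f := VComp.cols) ?_ (fun I _ J _ h => VComp.ext h)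
  refine ((List.finite_length_le (Fin l → Fin (d + 1)) d).image
    (List.map fun v i => (v i : ℕ))).subset ?_
  rintro _ ⟨I, hI, rfl⟩
  have hI' : ∑ r, pweight (I.col r) ≤ d := hI
  have hcol : ∀ c ∈ I.cols, ∀ i, c i < d + 1 := by
    intro c hc i
    obtain ⟨r, rfl⟩ := List.get_of_mem hc
    have h1 : I.col r i ≤ pweight (I.col r) :=
      Finset.single_le_sum (f := I.col r) (fun _ _ => Nat.zero_le _) (Finset.mem_univ i)
    have h2 : pweight (I.col r) ≤ ∑ r, pweight (I.col r) :=
      Finset.single_le_sum (f := fun r => pweight (I.col r)) (fun _ _ => Nat.zero_le _)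
        (Finset.mem_univ r)
    exact Nat.lt_succ_of_le (h1.trans (h2.trans hI'))
  refine ⟨I.cols.map fun c i => Fin.ofNat (d + 1) (c i), ?_, ?_⟩
  · have h1 : ∑ _r : Fin I.len, 1 ≤ ∑ r, pweight (I.col r) :=
      Finset.sum_le_sum fun r _ => pweight_pos (I.2 _ (List.get_mem _ _))
    have h2 : I.len ≤ d := by simpa using h1.trans hI'
    change (List.map _ I.cols).length ≤ d
    rw [List.length_map]
    exact h2
  · rw [List.map_map]
    conv_rhs => rw [← List.map_id I.cols]
    refine List.map_congr_left fun c hc => funext fun i => ?_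
    simpa using Nat.mod_eq_of_lt (hcol c hc i)

theorem finite_vcoeff (f : QSym l) : {I : VComp l | vcoeff I f ≠ 0}.Finite := by
  obtain ⟨d, hd⟩ := f.2.1
  refine (finite_bounded d).subset fun I hI => ?_
  have := hd _ hI
  rwa [degree_mono] at this

/-- The monomial functions form a basis. -/
noncomputable def basisM (l : ℕ) : Module.Basis (VComp l) ℚ (QSym l) := by
  classical
  refine Module.Basis.mk (v := M) ?_ ?_
  · rw [linearIndependent_iff']
    intro s a ha I hI
    have h := congrArg (vcoeff I) ha
    simpa [vcoeff_M, hI] using h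
  · intro f _
    have : f = ∑ I ∈ (finite_vcoeff f).toFinset, vcoeff I f • M I := by
      refine ext_vcoeff fun J => ?_
      rw [map_sum]
      simp only [map_smul, vcoeff_M, smul_eq_mul, mul_ite, mul_one, mul_zero]
      rw [Finset.sum_ite_eq']
      split_ifs with h
      · rfl
      · by_contra h'
        exact h ((Set.Finite.mem_toFinset _).2 h')
    rw [this]
    exact Submodule.sum_mem _ fun I _ =>
      Submodule.smul_mem _ _ (Submodule.subset_span ⟨I, rfl⟩)

@[simp] theorem basisM_apply (I : VComp l) : basisM l I = M I := by
  simp [basisM]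

/-- The coproduct `Δ(M_I) = ∑_{I = JK} M_J ⊗ M_K` (deconcatenation) and the counit, which is the
projection onto the degree `0` part. -/
noncomputable instance : CoalgebraStruct ℚ (QSym l) where
  comul := (basisM l).constr ℚ fun I =>
    ∑ r ∈ Finset.range (I.len + 1), M (I.take r) ⊗ₜ[ℚ] M (I.drop r)
  counit := (basisM l).constr ℚ fun I => if I.len = 0 then 1 else 0

theorem comul_M (I : VComp l) : CoalgebraStruct.comul (R := ℚ) (M I) =
    ∑ r ∈ Finset.range (I.len + 1), M (I.take r) ⊗ₜ[ℚ] M (I.drop r) := by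
  rw [← basisM_apply]
  exact (basisM l).constr_basis ℚ _ I

theorem counit_M (I : VComp l) :
    CoalgebraStruct.counit (R := ℚ) (M I) = if I.len = 0 then (1 : ℚ) else 0 := by
  rw [← basisM_apply]
  exact (basisM l).constr_basis ℚ _ I

theorem len_take {I : VComp l} {r : ℕ} (h : r ≤ I.len) : (I.take r).len = r := by
  have : r ≤ I.1.length := h
  simp [VComp.len, VComp.cols, VComp.take, this]

theorem len_drop (I : VComp l) (r : ℕ) : (I.drop r).len = I.len - r := by
  simp [VComp.len, VComp.cols, VComp.drop]

noncomputable instance : Coalgebra ℚ (QSym l) where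
  coassoc := by
    refine (basisM l).ext fun I => ?_
    simp only [basisM_apply, LinearMap.comp_apply, comul_M, map_sum, LinearMap.rTensor_tmul,
      LinearMap.lTensor_tmul, LinearEquiv.coe_coe, TensorProduct.sum_tmul, TensorProduct.tmul_sum,
      TensorProduct.assoc_tmul]
    have h1 : ∀ r ∈ Finset.range (I.len + 1),
        ∑ s ∈ Finset.range ((I.take r).len + 1),
          M ((I.take r).take s) ⊗ₜ[ℚ] (M ((I.take r).drop s) ⊗ₜ[ℚ] M (I.drop r)) =
        ∑ s ∈ Finset.range (r + 1),
          M (I.take s) ⊗ₜ[ℚ] (M ((I.drop s).take (r - s)) ⊗ₜ[ℚ] M (I.drop r)) := by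
      intro r hr
      rw [len_take (Nat.lt_succ_iff.1 (Finset.mem_range.1 hr))]
      refine Finset.sum_congr rfl fun s hs => ?_
      have hs' : s ≤ r := Nat.lt_succ_iff.1 (Finset.mem_range.1 hs)
      have e1 : (I.take r).take s = I.take s :=
        VComp.ext (by simp [VComp.cols, VComp.take, List.take_take, hs'])
      have e2 : (I.take r).drop s = (I.drop s).take (r - s) :=
        VComp.ext (by simp [VComp.cols, VComp.take, VComp.drop, List.drop_take])
      rw [e1, e2]
    rw [Finset.sum_congr rfl h1, sum_cut_cut I.len (fun s r =>
      M (I.take s) ⊗ₜ[ℚ] (M ((I.drop s).take (r - s)) ⊗ₜ[ℚ] M (I.drop r)))]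
    refine Finset.sum_congr rfl fun s _ => ?_
    rw [len_drop]
    refine Finset.sum_congr rfl fun t _ => ?_
    have e3 : I.drop (s + t) = (I.drop s).drop t :=
      VComp.ext (by simp [VComp.cols, VComp.drop, List.drop_drop])
    rw [e3, Nat.add_sub_cancel_left]
  rTensor_counit_comp_comul := by
    refine (basisM l).ext fun I => ?_
    simp only [basisM_apply, LinearMap.comp_apply, comul_M, map_sum, LinearMap.rTensor_tmul,
      counit_M, TensorProduct.mk_apply]
    rw [Finset.sum_eq_single 0]
    · rw [len_take (Nat.zero_le _), if_pos rfl]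
      rfl
    · intro r hr h0
      rw [len_take (Nat.lt_succ_iff.1 (Finset.mem_range.1 hr)), if_neg h0, TensorProduct.zero_tmul]
    · simp
  lTensor_counit_comp_comul := by
    refine (basisM l).ext fun I => ?_
    simp only [basisM_apply, LinearMap.comp_apply, comul_M, map_sum, LinearMap.lTensor_tmul,
      counit_M, LinearMap.flip_apply, TensorProduct.mk_apply]
    rw [Finset.sum_eq_single I.len]
    · rw [len_drop, Nat.sub_self, if_pos rfl]
      congr 2
      exact VComp.ext (by simp [VComp.cols, VComp.take, VComp.len])
    · intro r hr h0
      have := Nat.lt_succ_iff.1 (Finset.mem_range.1 hr)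
      rw [len_drop, if_neg (by omega), TensorProduct.tmul_zero]
    · simp

theorem mdeg_mono (I : VComp l) (j : Fin I.len → ℕ) : mdeg (I.mono j) = I.total := by
  have hadd : ∀ a b : (ℕ × Fin l) →₀ ℕ, mdeg (a + b) = mdeg a + mdeg b := fun a b =>
    Finsupp.sum_add_index' (fun x => Pi.single_zero _) (fun x u v => Pi.single_add (f := fun _ => ℕ) x.2 u v)
  let φ : ((ℕ × Fin l) →₀ ℕ) →+ (Fin l → ℕ) :=
    { toFun := mdeg, map_zero' := Finsupp.sum_zero_index, map_add' := hadd }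
  have h1 : ∀ (x : ℕ × Fin l) (a : ℕ), φ (Finsupp.single x a) = Pi.single x.2 a := fun x a =>
    Finsupp.sum_single_index (Pi.single_zero _)
  change φ (I.mono j) = _
  have h2 : ∀ c : Fin l → ℕ, ∑ i, Pi.single i (c i) = c := fun c =>
    Finset.univ_sum_single c
  simp only [VComp.mono, colMono, map_sum, h1, h2]
  have : I.total = (List.ofFn I.col).sum := by
    have : List.ofFn I.col = I.cols := List.ofFn_get I.cols
    rw [this]; rfl
  rw [this, List.sum_ofFn]

/-- The quasisymmetric functions that are homogeneous of multidegree `n`. -/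
def grade (l : ℕ) (n : Fin l → ℕ) : Submodule ℚ (QSym l) where
  carrier := {f | ∀ e, MvPowerSeries.coeff e f.1 ≠ 0 → mdeg e = n}
  add_mem' := by
    intro f g hf hg e he
    by_cases h : MvPowerSeries.coeff e f.1 = 0
    · refine hg e fun h' => he ?_
      change MvPowerSeries.coeff e (f.1 + g.1) = 0
      rw [map_add, h, h', add_zero]
    · exact hf e h
  zero_mem' := fun e he => (he rfl).elim
  smul_mem' := by
    intro a f hf e he
    refine hf e fun h => he ?_
    change MvPowerSeries.coeff e (a • f.1) = 0
    rw [map_smul, h, smul_zero]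

theorem M_mem_grade (I : VComp l) : M I ∈ grade l I.total := by
  classical
  intro e he
  obtain ⟨J, j, hj, rfl⟩ := VComp.exists_mono e
  have he' : MvPowerSeries.coeff (J.mono j) (monomialSeries I) ≠ 0 := he
  rw [coeff_monomialSeries I J j hj] at he'
  have : I = J := by by_contra h; exact he' (if_neg h)
  rw [this, mdeg_mono]

theorem basisM_repr (f : QSym l) (I : VComp l) : (basisM l).repr f I = vcoeff I f := by
  classical
  have : Finsupp.lapply I ∘ₗ (basisM l).repr.toLinearMap = vcoeff I := by
    refine (basisM l).ext fun J => ?_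
    rw [LinearMap.comp_apply, LinearEquiv.coe_coe, Module.Basis.repr_self, basisM_apply, vcoeff_M,
      Finsupp.lapply_apply, Finsupp.single_apply]
  exact LinearMap.congr_fun this f

theorem grade_eq_span (n : Fin l → ℕ) :
    grade l n = Submodule.span ℚ {f | ∃ I : VComp l, I.total = n ∧ f = M I} := by
  refine le_antisymm (fun f hf => ?_) (Submodule.span_le.2 ?_)
  · rw [← (basisM l).linearCombination_repr f, Finsupp.linearCombination_apply]
    refine Submodule.sum_mem _ fun I hI => Submodule.smul_mem _ _ (Submodule.subset_span ?_)
    rw [Finsupp.mem_support_iff, basisM_repr] at hI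
    exact ⟨I, by rw [← mdeg_mono I Fin.val]; exact hf _ hI, basisM_apply I⟩
  · rintro _ ⟨I, rfl, rfl⟩
    exact M_mem_grade I

noncomputable instance : DirectSum.Decomposition (grade l) :=
  DirectSum.Decomposition.ofLinearMap (grade l)
    ((basisM l).constr ℚ fun I => DirectSum.lof ℚ (Fin l → ℕ) (fun n => grade l n) I.total
      ⟨M I, M_mem_grade I⟩)
    (by
      refine (basisM l).ext fun I => ?_
      rw [LinearMap.comp_apply, Module.Basis.constr_basis]
      simp)
    (by
      refine DirectSum.linearMap_ext ℚ fun n => LinearMap.ext fun f => ?_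
      obtain ⟨f, hf⟩ := f
      have key : ∀ f ∈ grade l n, ∀ hf : f ∈ grade l n,
          ((basisM l).constr ℚ fun I => DirectSum.lof ℚ (Fin l → ℕ) (fun n => grade l n) I.total
            ⟨M I, M_mem_grade I⟩) f =
          DirectSum.lof ℚ (Fin l → ℕ) (fun n => grade l n) n ⟨f, hf⟩ := by
        intro f h
        rw [grade_eq_span] at h
        induction h using Submodule.span_induction with
        | mem x hx =>
          obtain ⟨I, rfl, rfl⟩ := hx
          intro hf
          conv_lhs => rw [← basisM_apply, Module.Basis.constr_basis]
        | zero =>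
          intro hf
          rw [map_zero]
          exact (map_zero (DirectSum.lof ℚ (Fin l → ℕ) (fun n => grade l n) n)).symm
        | add x y hx hy ihx ihy =>
          intro hf
          rw [← grade_eq_span] at hx hy
          rw [map_add, ihx hx, ihy hy, ← map_add]
          rfl
        | smul a x hx ih =>
          intro hf
          rw [← grade_eq_span] at hx
          rw [map_smul, ih hx, ← map_smul]
          rfl
      simpa using key f hf hf)

instance : GradedCoalg (grade l) where
  counit_eq_zero := by
    intro n hn x hx
    have : grade l n ≤ LinearMap.ker (Coalgebra.counit (R := ℚ) (A := QSym l)) := by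
      rw [grade_eq_span, Submodule.span_le]
      rintro _ ⟨I, rfl, rfl⟩
      rw [SetLike.mem_coe, LinearMap.mem_ker]
      refine (counit_M I).trans (if_neg fun h => hn ?_)
      have h' : I.cols = [] := List.length_eq_zero_iff.1 h
      rw [VComp.total, h', List.sum_nil]
    exact this hx
  comul_mem := by
    intro n x hx
    have : grade l n ≤ (⨆ p : {p : (Fin l → ℕ) × (Fin l → ℕ) // p.1 + p.2 = n},
        LinearMap.range (TensorProduct.map (grade l p.1.1).subtype
          (grade l p.1.2).subtype)).comap (Coalgebra.comul (R := ℚ) (A := QSym l)) := by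
      rw [grade_eq_span, Submodule.span_le]
      rintro _ ⟨I, rfl, rfl⟩
      rw [SetLike.mem_coe, Submodule.mem_comap]
      refine (comul_M I).symm ▸ Submodule.sum_mem _ fun r _ => ?_
      refine Submodule.mem_iSup_of_mem
        (⟨((I.take r).total, (I.drop r).total), ?_⟩ :
          {p : (Fin l → ℕ) × (Fin l → ℕ) // p.1 + p.2 = I.total}) ?_
      · exact List.sum_take_add_sum_drop I.1 r
      · exact ⟨⟨M (I.take r), M_mem_grade _⟩ ⊗ₜ ⟨M (I.drop r), M_mem_grade _⟩, rfl⟩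
    exact this hx

/-- The universal character: `ζ(M_I)` is `1` if `I` has at most one column and `0` otherwise. -/
noncomputable def zeta (l : ℕ) : QSym l →ₗ[ℚ] ℚ :=
  (basisM l).constr ℚ fun I => if I.len ≤ 1 then 1 else 0

/-- The `k`-even ideal of `(QSym, ζ)`, in the graded dual of `QSym`. -/
noncomputable def kEvenIdeal (l : ℕ) (k : Fin l → ℕ∞) : TwoSidedIdeal (gradedDual (grade l)) :=
  evenIdeal (grade l) (zeta l) k

/-- The `k`-even subalgebra of `(QSym, ζ)`. -/
noncomputable def kEvenSub (l : ℕ) (k : Fin l → ℕ∞) : Submodule ℚ (QSym l) :=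
  evenSub (grade l) (zeta l) k

end QSym

/-! ### Noncommutative power series and noncommutative symmetric functions of level `l` -/

/-- Noncommutative formal power series over `ℚ` in the letters `A`: functions on words. -/
@[ext] structure NCSeries (A : Type*) where
  /-- The coefficient of a word. -/
  coeff : List A → ℚ

namespace NCSeries

variable {A : Type*}

/-- A series is the family of its coefficients. -/
def equivFun (A : Type*) : NCSeries A ≃ (List A → ℚ) := ⟨coeff, mk, fun _ => rfl, fun _ => rfl⟩

noncomputable instance : AddCommGroup (NCSeries A) := (equivFun A).addCommGroup

noncomputable instance : Module ℚ (NCSeries A) := (equivFun A).module ℚ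

/-- The concatenation product: the coefficient of `w` in `f g` is `∑_{w = uv} f_u g_v`. -/
noncomputable instance : Mul (NCSeries A) :=
  ⟨fun f g => ⟨fun w =>
    ∑ r ∈ Finset.range (w.length + 1), f.coeff (w.take r) * g.coeff (w.drop r)⟩⟩

open Classical in
noncomputable instance : One (NCSeries A) := ⟨⟨fun w => if w = [] then 1 else 0⟩⟩

theorem coeff_add (f g : NCSeries A) (w : List A) :
    (f + g).coeff w = f.coeff w + g.coeff w := rfl

theorem coeff_zero (w : List A) : (0 : NCSeries A).coeff w = 0 := rfl

theorem coeff_smul (a : ℚ) (f : NCSeries A) (w : List A) :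
    (a • f).coeff w = a * f.coeff w := rfl

theorem coeff_mul (f g : NCSeries A) (w : List A) : (f * g).coeff w =
    ∑ r ∈ Finset.range (w.length + 1), f.coeff (w.take r) * g.coeff (w.drop r) := rfl

open Classical in
theorem coeff_one (w : List A) : (1 : NCSeries A).coeff w = if w = [] then 1 else 0 := rfl

noncomputable instance : Ring (NCSeries A) where
  __ := (inferInstance : AddCommGroup (NCSeries A))
  left_distrib f g h := NCSeries.ext <| funext fun w => by
    simp only [coeff_mul, coeff_add, mul_add, Finset.sum_add_distrib]
  right_distrib f g h := NCSeries.ext <| funext fun w => by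
    simp only [coeff_mul, coeff_add, add_mul, Finset.sum_add_distrib]
  zero_mul f := NCSeries.ext <| funext fun w => by
    simp only [coeff_mul, coeff_zero, zero_mul, Finset.sum_const_zero]
  mul_zero f := NCSeries.ext <| funext fun w => by
    simp only [coeff_mul, coeff_zero, mul_zero, Finset.sum_const_zero]
  one_mul f := NCSeries.ext <| funext fun w => by
    rw [coeff_mul, Finset.sum_eq_single 0]
    · simp [coeff_one]
    · intro r hr h0
      have h1 := Nat.lt_succ_iff.1 (Finset.mem_range.1 hr)
      have h2 : w.take r ≠ [] := by
        intro h
        have := congrArg List.length h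
        simp at this
        rcases this with h | h
        · exact h0 h
        · subst h; simp at h1; exact h0 h1
      rw [coeff_one, if_neg h2, zero_mul]
    · simp
  mul_one f := NCSeries.ext <| funext fun w => by
    rw [coeff_mul, Finset.sum_eq_single w.length]
    · simp [coeff_one]
    · intro r hr h0
      have h1 := Nat.lt_succ_iff.1 (Finset.mem_range.1 hr)
      have h2 : w.drop r ≠ [] := by
        intro h
        have := List.drop_eq_nil_iff.1 h
        omega
      rw [coeff_one, if_neg h2, mul_zero]
    · simp
  mul_assoc f g h := NCSeries.ext <| funext fun w => by
    simp only [coeff_mul, Finset.sum_mul, Finset.mul_sum]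
    have h1 : ∀ r ∈ Finset.range (w.length + 1),
        ∑ s ∈ Finset.range ((w.take r).length + 1),
          f.coeff ((w.take r).take s) * g.coeff ((w.take r).drop s) * h.coeff (w.drop r) =
        ∑ s ∈ Finset.range (r + 1),
          f.coeff (w.take s) * (g.coeff ((w.drop s).take (r - s)) * h.coeff (w.drop r)) := by
      intro r hr
      rw [List.length_take, min_eq_left (Nat.lt_succ_iff.1 (Finset.mem_range.1 hr))]
      refine Finset.sum_congr rfl fun s hs => ?_
      have hs' : s ≤ r := Nat.lt_succ_iff.1 (Finset.mem_range.1 hs)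
      rw [List.take_take, min_eq_left hs', List.drop_take, mul_assoc]
    rw [Finset.sum_congr rfl h1, sum_cut_cut w.length (fun s r =>
      f.coeff (w.take s) * (g.coeff ((w.drop s).take (r - s)) * h.coeff (w.drop r)))]
    refine Finset.sum_congr rfl fun s _ => ?_
    rw [List.length_drop]
    refine Finset.sum_congr rfl fun t _ => ?_
    rw [Nat.add_sub_cancel_left, List.drop_drop]

noncomputable instance : Algebra ℚ (NCSeries A) :=
  Algebra.ofModule
    (fun a f g => NCSeries.ext <| funext fun w => by
      simp only [coeff_mul, coeff_smul, Finset.mul_sum, mul_assoc])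
    (fun a f g => NCSeries.ext <| funext fun w => by
      simp only [coeff_mul, coeff_smul, Finset.mul_sum, mul_left_comm])

end NCSeries

section NSymDef

variable {l : ℕ}

/-- For a colored permutation `(σ, u)` of `n`, the noncommutative power series
`F_{σ,u} = ∑ (j_{σ⁻¹(1)} ⋯ j_{σ⁻¹(n)}, u_{σ⁻¹(1)} ⋯ u_{σ⁻¹(n)})` over the sequences
`j_1 ≤ ⋯ ≤ j_n` with `j_r < j_{r+1}` for every descent `r` of `σ`. The letters are the colored
integers `(j, color)`. -/
noncomputable def freeF {n : ℕ} (σ : Equiv.Perm (Fin n)) (u : Fin n → Fin l) :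
    NCSeries (ℕ × Fin l) :=
  ⟨fun w => (Nat.card {j : Fin n → ℕ // Monotone j ∧
      (∀ r s : Fin n, r.val + 1 = s.val → σ s < σ r → j r < j s) ∧
      List.ofFn (fun r => (j (σ.symm r), u (σ.symm r))) = w} : ℚ)⟩

/-- The multidegree of a color word. -/
def colorDeg {n : ℕ} (u : Fin n → Fin l) : Fin l → ℕ :=
  fun i => (Finset.univ.filter fun r => u r = i).card

/-- The complete homogeneous noncommutative symmetric function
`S_n = ∑ F_{12⋯|n|, u}`, over the color words `u` of multidegree `n`. -/
noncomputable def completeS (n : Fin l → ℕ) : NCSeries (ℕ × Fin l) :=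
  ∑ u : Fin (pweight n) → Fin l with colorDeg u = n, freeF 1 u

/-- The algebra of noncommutative symmetric functions of level `l`: the subalgebra generated by
the complete functions `S_n`. -/
noncomputable def NSym (l : ℕ) : Subalgebra ℚ (NCSeries (ℕ × Fin l)) :=
  Algebra.adjoin ℚ (Set.range completeS)

namespace NSym

/-- `S_n` as an element of `NSym`. -/
noncomputable def S (n : Fin l → ℕ) : NSym l := ⟨completeS n, Algebra.subset_adjoin ⟨n, rfl⟩⟩

/-- `S^I = S_{i_1} ⋯ S_{i_m}` for a vector composition `I = (i_1, …, i_m)`. -/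
noncomputable def SProd (I : VComp l) : NSym l := (I.cols.map S).prod

open Classical in
/-- The condition that an isomorphism from `NSym` to the graded dual of `QSym` is the one that
makes the `S^I` the dual basis of the `M_J`: `S^I(M_J) = δ_{I,J}`. -/
def IsDuality (θ : NSym l ≃ₐ[ℚ] gradedDual (QSym.grade l)) : Prop :=
  ∀ I J : VComp l, (θ (SProd I)).1.ofConv (QSym.M J) = if I = J then 1 else 0

end NSym

end NSymDef

/-! Two bases are matched: the products `SProd I` of `NSym`, and the coefficient functionals `dualM
I` of the graded dual of `QSym`. Both multiply by concatenation, the second because convolution is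
dual to deconcatenation (`dualM_mul`). Hence `SProd I ↦ dualM I` is an algebra isomorphism. A
duality is forced to take these values on a basis, so it is unique (`isDuality_iff_eq`).

The substantial point is the linear independence of the `S^I` as noncommutative series, a
triangularity argument. A factor `S_n` only contains words with weakly increasing positions. On a
word made of blocks whose positions drop from block to block, no factor can reach across two blocks.
So `S^I` needs at least as many columns as there are blocks, and with equal numbers its columns are
the multidegrees of the blocks (`length_le_of_coeff_ne_zero`).

For the ideal: the only composition of total `n ≠ 0` with at most one column is `(n)`, so `ζ_n` is
the functional dual to `M_(n)`, that is, `S_n`. The component of `bar ζ` is `(-1)^{|n|} ζ_n`, so the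
generator is `0` for even `|n|` and `-2 S_n` for odd `|n|`, and `2` is invertible.

For the subcoalgebra: the proposed span is admissible since cutting a composition creates no new
columns. Conversely, let `C` be admissible and `c ≤ k` of odd weight. Then `ζ_c` vanishes on `C`.
Functionals vanishing on a subcoalgebra absorb convolution, so the functional dual to `M_{A(c)B}`, a
convolution product with middle factor `ζ_c`, vanishes on `C` too (`le_evenSpan`). -/

/-! ### Concatenation of vector compositions -/

namespace VComp

variable {l : ℕ}

/-- Concatenation of vector compositions. -/
def append (I J : VComp l) : VComp l :=
  ⟨I.1 ++ J.1, fun c hc => (List.mem_append.1 hc).elim (I.2 c) (J.2 c)⟩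

/-- The empty vector composition. -/
def empty (l : ℕ) : VComp l := ⟨[], by simp⟩

/-- The vector composition with the single column `n`. -/
def single (n : Fin l → ℕ) (hn : n ≠ 0) : VComp l := ⟨[n], by simpa using hn⟩

theorem take_append_drop (I : VComp l) (r : ℕ) : (I.take r).append (I.drop r) = I :=
  Subtype.ext (List.take_append_drop r I.1)

theorem take_append_len (I J : VComp l) : (I.append J).take I.len = I :=
  Subtype.ext (List.take_left (l₁ := I.1) (l₂ := J.1))

theorem drop_append_len (I J : VComp l) : (I.append J).drop I.len = J :=
  Subtype.ext (List.drop_left (l₁ := I.1) (l₂ := J.1))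

theorem len_append (I J : VComp l) : (I.append J).len = I.len + J.len :=
  List.length_append

theorem total_single (n : Fin l → ℕ) (hn : n ≠ 0) : (single n hn).total = n :=
  List.sum_singleton

theorem eq_single_of_len_le_one {I : VComp l} {n : Fin l → ℕ} (hn : n ≠ 0) (hI : I.total = n)
    (hlen : I.len ≤ 1) : I = single n hn := by
  obtain ⟨L, hL⟩ := I
  match L, hL, hI, hlen with
  | [], _, hI, _ => exact absurd hI.symm hn
  | [c], _, hI, _ =>
    have : c = n := List.sum_singleton.symm.trans hI
    subst this
    rfl
  | _ :: _ :: _, _, _, hlen => simp [len, cols] at hlen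

theorem pweight_total (I : VComp l) : pweight I.total = ∑ r, pweight (I.col r) := by
  have h : I.total = ∑ r, I.col r := by
    rw [← List.sum_ofFn]
    exact congrArg List.sum (List.ofFn_get I.cols).symm
  simp only [h, pweight, Finset.sum_apply]
  exact Finset.sum_comm

end VComp

/-! ### The graded dual of `QSym` and its basis of coefficient functionals -/

namespace QSym

variable {l : ℕ}

open Classical in
theorem zeta_M (I : VComp l) : zeta l (M I) = if I.len ≤ 1 then 1 else 0 := by
  rw [← basisM_apply]
  exact (basisM l).constr_basis ℚ _ I

theorem ext_M {f g : QSym l →ₗ[ℚ] ℚ} (h : ∀ I, f (M I) = g (M I)) : f = g :=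
  (basisM l).ext fun I => by rw [basisM_apply, h I]

/-- The convolution product of functionals on `M_K` is a sum over deconcatenations. -/
theorem convMul_M (f g : WithConv (QSym l →ₗ[ℚ] ℚ)) (K : VComp l) :
    (f * g).ofConv (M K) =
      ∑ r ∈ Finset.range (K.len + 1), f.ofConv (M (K.take r)) * g.ofConv (M (K.drop r)) := by
  change (f * g) (M K) = _
  rw [LinearMap.convMul_apply]
  erw [comul_M]
  simp only [map_sum, TensorProduct.map_tmul, LinearMap.mul'_apply]

/-- Among the cuts of `K`, only the one after `I.len` columns can give the pair `(I, J)`, and it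
does so exactly when `K` is the concatenation. -/
theorem vcoeff_convMul_vcoeff (I J : VComp l) :
    WithConv.toConv (vcoeff I) * WithConv.toConv (vcoeff J) =
      WithConv.toConv (vcoeff (I.append J)) := by
  classical
  refine WithConv.ofConv_injective (ext_M fun K => ?_)
  rw [convMul_M]
  simp only [vcoeff_M]
  split_ifs with h
  · subst h
    rw [Finset.sum_eq_single I.len]
    · rw [VComp.take_append_len, VComp.drop_append_len, if_pos rfl, if_pos rfl, one_mul]
    · intro r hr hne
      rw [if_neg, zero_mul]
      intro h
      have := len_take (Nat.lt_succ_iff.1 (Finset.mem_range.1 hr))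
      rw [h] at this
      exact hne this.symm
    · intro h
      rw [VComp.len_append] at h
      exact absurd (Finset.mem_range.2 (by omega)) h
  · refine Finset.sum_eq_zero fun r _ => ?_
    by_cases hI : K.take r = I
    · by_cases hJ : K.drop r = J
      · exact absurd (hI ▸ hJ ▸ K.take_append_drop r).symm h
      · rw [if_neg hJ, mul_zero]
    · rw [if_neg hI, zero_mul]

theorem vcoeff_eq_zero_of_mem_grade {n : Fin l → ℕ} {f : QSym l} (hf : f ∈ grade l n)
    {I : VComp l} (hI : I.total ≠ n) : vcoeff I f = 0 := by
  by_contra h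
  exact hI ((mdeg_mono I Fin.val).symm.trans (hf _ h))

/-- The functional that reads off the coefficient of `M_I`, as an element of the graded dual. -/
noncomputable def dualM (I : VComp l) : gradedDual (grade l) :=
  ⟨WithConv.toConv (vcoeff I), {I.total}, fun n hn x hx =>
    vcoeff_eq_zero_of_mem_grade hx fun h => hn (by simp [h])⟩

theorem ext_gradedDual {f g : gradedDual (grade l)}
    (h : ∀ I, f.1.ofConv (M I) = g.1.ofConv (M I)) : f = g :=
  Subtype.ext (WithConv.ofConv_injective (ext_M h))

open Classical in
theorem dualM_M (I J : VComp l) : (dualM I).1.ofConv (M J) = if I = J then 1 else 0 :=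
  (vcoeff_M J I).trans (by simp only [eq_comm])

theorem dualM_mul (I J : VComp l) : dualM I * dualM J = dualM (I.append J) :=
  Subtype.ext (vcoeff_convMul_vcoeff I J)

theorem dualM_empty : dualM (VComp.empty l) = 1 := by
  classical
  refine ext_gradedDual fun J => ?_
  rw [dualM_M]
  -- The convolution unit is the counit, which detects the empty composition.
  change _ = (1 : WithConv (QSym l →ₗ[ℚ] ℚ)) (M J)
  rw [LinearMap.convOne_apply]
  erw [counit_M]
  have : VComp.empty l = J ↔ J.len = 0 :=
    ⟨fun h => h ▸ rfl, fun h => Subtype.ext (List.length_eq_zero_iff.1 h).symm⟩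
  simp only [this]

theorem finite_total (n : Fin l → ℕ) : {I : VComp l | I.total = n}.Finite := by
  refine (finite_bounded (pweight n)).subset fun I hI => ?_
  have hI : I.total = n := hI
  rw [Set.mem_ofPred_eq, ← hI, VComp.pweight_total]

theorem finsetSum_gradedDual_apply {ι : Type*} (s : Finset ι) (a : ι → gradedDual (grade l))
    (x : QSym l) : (∑ i ∈ s, a i).1.ofConv x = ∑ i ∈ s, (a i).1.ofConv x := by
  classical
  induction s using Finset.induction_on with
  | empty => rfl
  | insert i s hi ih => rw [Finset.sum_insert hi, Finset.sum_insert hi, ← ih]; rfl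

/-- The coefficient functionals form a basis of the graded dual. -/
noncomputable def basisDual (l : ℕ) : Module.Basis (VComp l) ℚ (gradedDual (grade l)) := by
  classical
  refine Module.Basis.mk (v := dualM) ?_ ?_
  · rw [linearIndependent_iff'ₛ]
    intro s a b hab I hI
    have h := congrArg (fun f : gradedDual (grade l) => f.1.ofConv (M I)) hab
    simp only [finsetSum_gradedDual_apply] at h
    have h2 : ∀ (a : VComp l → ℚ) (i), (a i • dualM i).1.ofConv (M I) =
      a i * (dualM i).1.ofConv (M I) := fun a i => rfl
    simp only [h2, dualM_M, mul_ite, mul_one, mul_zero, Finset.sum_ite_eq', if_pos hI] at h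
    exact h
  · rintro f -
    obtain ⟨s, hs⟩ := f.2
    -- `f` lives in finitely many degrees, each containing finitely many `M_I`, so its expansion is
    -- a finite sum.
    have hfin : (⋃ n ∈ s, {I : VComp l | I.total = n}).Finite :=
      s.finite_toSet.biUnion fun n _ => finite_total n
    have : f = ∑ I ∈ hfin.toFinset, f.1.ofConv (M I) • dualM I := by
      refine ext_gradedDual fun J => ?_
      rw [finsetSum_gradedDual_apply]
      have h2 : ∀ I, (f.1.ofConv (M I) • dualM I).1.ofConv (M J) =
        f.1.ofConv (M I) * (dualM I).1.ofConv (M J) := fun i => rfl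
      simp only [h2, dualM_M, mul_ite, mul_one, mul_zero, Finset.sum_ite_eq']
      split_ifs with h
      · rfl
      · refine hs J.total (fun hJ => h ?_) _ (M_mem_grade J)
        simpa using hJ
    rw [this]
    exact Submodule.sum_mem _ fun I _ =>
      Submodule.smul_mem _ _ (Submodule.subset_span ⟨I, rfl⟩)

@[simp] theorem basisDual_apply (I : VComp l) : basisDual l I = dualM I := by
  simp [basisDual]

/-! ### Homogeneous components of the universal character -/

theorem gproj_of_mem {n : Fin l → ℕ} {x : QSym l} (hx : x ∈ grade l n) :
    gproj (grade l) n x = x :=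
  DirectSum.decompose_of_mem_same (grade l) hx

theorem gproj_of_mem_ne {m n : Fin l → ℕ} {x : QSym l} (hx : x ∈ grade l m) (h : m ≠ n) :
    gproj (grade l) n x = 0 :=
  DirectSum.decompose_of_mem_ne (grade l) hx h

theorem bar_of_mem (φ : QSym l →ₗ[ℚ] ℚ) {n : Fin l → ℕ} {x : QSym l} (hx : x ∈ grade l n) :
    bar (grade l) φ x = (-1) ^ pweight n * φ x := by
  lift x to grade l n using hx
  simp [bar]

/-- In degree `n ≠ 0` the empty composition is excluded, so `ζ` sees only the single column `n`. -/
theorem zeta_gproj {n : Fin l → ℕ} (hn : n ≠ 0) :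
    zeta l ∘ₗ gproj (grade l) n = vcoeff (VComp.single n hn) := by
  classical
  refine ext_M fun I => ?_
  rw [LinearMap.comp_apply, vcoeff_M]
  by_cases h : I.total = n
  · rw [gproj_of_mem (h ▸ M_mem_grade I), zeta_M]
    refine if_congr ⟨VComp.eq_single_of_len_le_one hn h, ?_⟩ rfl rfl
    rintro rfl
    exact le_rfl
  · rw [gproj_of_mem_ne (M_mem_grade I) h, map_zero, if_neg]
    rintro rfl
    exact h (VComp.total_single n hn)

theorem dualComponent_zeta {n : Fin l → ℕ} (hn : n ≠ 0) :
    dualComponent (grade l) (zeta l) n = dualM (VComp.single n hn) :=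
  Subtype.ext (congrArg WithConv.toConv (zeta_gproj hn))

theorem dualComponent_bar (φ : QSym l →ₗ[ℚ] ℚ) (n : Fin l → ℕ) :
    dualComponent (grade l) (bar (grade l) φ) n =
      ((-1 : ℚ) ^ pweight n) • dualComponent (grade l) φ n :=
  Subtype.ext (WithConv.ofConv_injective (LinearMap.ext fun x =>
    bar_of_mem φ (DirectSum.decompose (grade l) x n).2))

/-! ### The even subcoalgebra -/

/-- A functional that vanishes on a subcoalgebra generates a two-sided convolution ideal of such
functionals. -/
theorem convMul_mem_of_isSubcoalg {C : Submodule ℚ (QSym l)} (hC : IsSubcoalg C)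
    {f g : WithConv (QSym l →ₗ[ℚ] ℚ)}
    (h : (∀ x ∈ C, f.ofConv x = 0) ∨ ∀ x ∈ C, g.ofConv x = 0) :
    ∀ x ∈ C, (f * g).ofConv x = 0 := by
  intro x hx
  obtain ⟨y, hy⟩ := hC x hx
  change (f * g) x = 0
  rw [LinearMap.convMul_apply, ← hy, ← LinearMap.comp_apply (TensorProduct.map _ _),
    ← TensorProduct.map_comp]
  have : TensorProduct.map (f.ofConv ∘ₗ C.subtype) (g.ofConv ∘ₗ C.subtype) = 0 := by
    rcases h with h | h
    · rw [show f.ofConv ∘ₗ C.subtype = 0 from LinearMap.ext fun x => h x x.2,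
        TensorProduct.map_zero_left]
    · rw [show g.ofConv ∘ₗ C.subtype = 0 from LinearMap.ext fun x => h x x.2,
        TensorProduct.map_zero_right]
  rw [this]
  simp

/-- The span of the `M_I` with `I` avoiding the columns `n ≤ k` of odd weight. -/
noncomputable def evenSpan (l : ℕ) (k : Fin l → ℕ∞) : Submodule ℚ (QSym l) :=
  Submodule.span ℚ {f | ∃ I : VComp l, (∀ c ∈ I.cols, PLe c k → Even (pweight c)) ∧ f = M I}

/-- The columns of `take` and `drop` are columns of `I`, which gives the subcoalgebra property.
Agreement is tested degree by degree on the `M_I`: beyond degree `0`, `ζ` is nonzero only on single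
columns, and these have even weight when `n ≤ k`. -/
theorem evenSpan_mem_agreeing (k : Fin l → ℕ∞) :
    evenSpan l k ∈ agreeingSubcoalgs (grade l) (bar (grade l) (zeta l)) (zeta l) k := by
  classical
  refine ⟨?_, ?_, ?_⟩
  · intro n x hx
    have : evenSpan l k ≤ (evenSpan l k).comap (gproj (grade l) n) := by
      refine Submodule.span_le.2 ?_
      rintro _ ⟨I, hI, rfl⟩
      rw [SetLike.mem_coe, Submodule.mem_comap]
      by_cases h : I.total = n
      · rw [gproj_of_mem (h ▸ M_mem_grade I)]
        exact Submodule.subset_span ⟨I, hI, rfl⟩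
      · rw [gproj_of_mem_ne (M_mem_grade I) h]
        exact zero_mem _
    exact this hx
  · intro x hx
    have : evenSpan l k ≤ (LinearMap.range (TensorProduct.map (evenSpan l k).subtype
        (evenSpan l k).subtype)).comap (Coalgebra.comul (R := ℚ) (A := QSym l)) := by
      refine Submodule.span_le.2 ?_
      rintro _ ⟨I, hI, rfl⟩
      rw [SetLike.mem_coe, Submodule.mem_comap]
      refine (comul_M I).symm ▸ Submodule.sum_mem _ fun r _ => ?_
      exact ⟨⟨M (I.take r), Submodule.subset_span
          ⟨I.take r, fun c hc => hI c (List.mem_of_mem_take hc), rfl⟩⟩ ⊗ₜ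
        ⟨M (I.drop r), Submodule.subset_span
          ⟨I.drop r, fun c hc => hI c (List.mem_of_mem_drop hc), rfl⟩⟩, rfl⟩
    exact this hx
  · intro h hh hk
    have key : ∀ n, PLe n k →
        (bar (grade l) (zeta l) - zeta l) (gproj (grade l) n h) = 0 := by
      intro n hn
      have : evenSpan l k ≤
          LinearMap.ker ((bar (grade l) (zeta l) - zeta l) ∘ₗ gproj (grade l) n) := by
        refine Submodule.span_le.2 ?_
        rintro _ ⟨I, hI, rfl⟩
        rw [SetLike.mem_coe, LinearMap.mem_ker, LinearMap.comp_apply]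
        by_cases h : I.total = n
        · rw [gproj_of_mem (h ▸ M_mem_grade I), LinearMap.sub_apply,
            bar_of_mem _ (M_mem_grade I), zeta_M]
          split_ifs with hlen
          -- In degree `0` there is no column to which the parity condition could apply, but the
          -- sign is `(-1)^0`.
          · by_cases hn0 : n = 0
            · simp [h, hn0, pweight]
            · have hI' := VComp.eq_single_of_len_le_one hn0 h hlen
              have : Even (pweight n) := hI n (by rw [hI']; exact List.mem_singleton_self n) hn
              rw [h, this.neg_one_pow]
              simp
          · simp
        · rw [gproj_of_mem_ne (M_mem_grade I) h, map_zero]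
      exact this hh
    have h2 : ∀ n, ¬ PLe n k → gproj (grade l) n h = 0 := by
      intro n hn
      have : (⨆ n : {n : Fin l → ℕ // PLe n k}, grade l n) ≤ LinearMap.ker (gproj (grade l) n) :=
        iSup_le fun m x hx => gproj_of_mem_ne hx fun e => hn (e ▸ m.2)
      exact this hk
    rw [← sub_eq_zero, ← LinearMap.sub_apply, ← DirectSum.sum_support_decompose (grade l) h,
      map_sum]
    refine Finset.sum_eq_zero fun n _ => ?_
    change (bar (grade l) (zeta l) - zeta l) (gproj (grade l) n h) = 0
    by_cases hn : PLe n k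
    · exact key n hn
    · rw [h2 n hn, map_zero]

/-- On the component of odd weight the agreement reads `-ζ = ζ`, and that component stays in `C`
because `C` is graded. -/
theorem vcoeff_single_eq_zero {k : Fin l → ℕ∞} {C : Submodule ℚ (QSym l)}
    (hC : C ∈ agreeingSubcoalgs (grade l) (bar (grade l) (zeta l)) (zeta l) k)
    {n : Fin l → ℕ} (hn : n ≠ 0) (hnk : PLe n k) (hodd : Odd (pweight n)) :
    ∀ x ∈ C, vcoeff (VComp.single n hn) x = 0 := by
  intro x hx
  rw [← zeta_gproj hn, LinearMap.comp_apply]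
  have h1 : gproj (grade l) n x ∈ grade l n := (DirectSum.decompose (grade l) x n).2
  have h2 := hC.2.2 (gproj (grade l) n x) (hC.1 n hx)
    (Submodule.mem_iSup_of_mem (⟨n, hnk⟩ : {n : Fin l → ℕ // PLe n k}) h1)
  rw [bar_of_mem _ h1, hodd.neg_one_pow] at h2
  linarith

theorem le_evenSpan {k : Fin l → ℕ∞} {C : Submodule ℚ (QSym l)}
    (hC : C ∈ agreeingSubcoalgs (grade l) (bar (grade l) (zeta l)) (zeta l) k) :
    C ≤ evenSpan l k := by
  intro x hx
  rw [← (basisM l).linearCombination_repr x, Finsupp.linearCombination_apply]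
  refine Submodule.sum_mem _ fun I hI => Submodule.smul_mem _ _ (Submodule.subset_span ?_)
  rw [Finsupp.mem_support_iff, basisM_repr] at hI
  refine ⟨I, fun c hc hck => ?_, basisM_apply I⟩
  by_contra hodd
  rw [Nat.not_even_iff_odd] at hodd
  have hc0 := I.2 c hc
  obtain ⟨s, t, hst⟩ := List.append_of_mem hc
  -- Isolating the forbidden column `c` factors the coefficient functional of `I` as a convolution
  -- product of those of `A`, `(c)` and `B`.
  obtain ⟨A, B, hIeq⟩ : ∃ A B : VComp l, I = (A.append (VComp.single c hc0)).append B :=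
    ⟨⟨s, fun d hd => I.2 d (hst ▸ List.mem_append_left _ hd : d ∈ I.cols)⟩,
      ⟨t, fun d hd => I.2 d
        (hst ▸ List.mem_append_right _ (List.mem_cons_of_mem _ hd) : d ∈ I.cols)⟩,
      VComp.ext (hst.trans (by simp [VComp.append, VComp.single, VComp.cols]))⟩
  refine hI ?_
  change (WithConv.toConv (vcoeff I)).ofConv x = 0
  rw [hIeq, ← vcoeff_convMul_vcoeff, ← vcoeff_convMul_vcoeff]
  exact convMul_mem_of_isSubcoalg hC.2.1 (Or.inl (convMul_mem_of_isSubcoalg hC.2.1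
    (Or.inr (vcoeff_single_eq_zero hC hc0 hck hodd)))) x hx

theorem kEvenSub_eq_evenSpan (k : Fin l → ℕ∞) : kEvenSub l k = evenSpan l k :=
  (canonicalSub_isGreatest (grade l) _ _ k).unique
    ⟨evenSpan_mem_agreeing k, fun _ hC => le_evenSpan hC⟩

end QSym

/-! ### Coefficients of the complete functions -/

namespace NCSeries

variable {A : Type*}

theorem coeff_sum {ι : Type*} (s : Finset ι) (f : ι → NCSeries A) (w : List A) :
    (∑ i ∈ s, f i).coeff w = ∑ i ∈ s, (f i).coeff w := by
  classical
  induction s using Finset.induction_on with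
  | empty => rfl
  | insert i s hi ih => rw [Finset.sum_insert hi, Finset.sum_insert hi, ← ih]; rfl

end NCSeries

namespace NSym

variable {l : ℕ}

/-- The multidegree of a list of colors. -/
def listDeg (v : List (Fin l)) : Fin l → ℕ := fun i => v.count i

theorem listDeg_ofFn {n : ℕ} (u : Fin n → Fin l) : listDeg (List.ofFn u) = colorDeg u := by
  funext i
  simp only [listDeg, colorDeg, Finset.card_filter]
  induction n with
  | zero => simp
  | succ n ih =>
    rw [List.ofFn_succ, List.count_cons, Fin.sum_univ_succ, ih, add_comm]
    simp only [beq_iff_eq]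

theorem pweight_listDeg (v : List (Fin l)) : pweight (listDeg v) = v.length := by
  have := Multiset.sum_count_eq_card (s := Finset.univ) (m := (v : Multiset (Fin l)))
    fun a _ => Finset.mem_univ a
  simpa [pweight, listDeg] using this

theorem exists_listDeg_eq (n : Fin l → ℕ) : ∃ v : List (Fin l), listDeg v = n := by
  refine ⟨(∑ i, Multiset.replicate (n i) i).toList, funext fun i => ?_⟩
  rw [listDeg, ← Multiset.coe_count, Multiset.coe_toList, Multiset.count_sum']
  simp [Multiset.count_replicate]

-- The identity has no descents, so the strictness condition is vacuous; the word itself determines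
-- both `j` and `u`, so it occurs at most once.
open Classical in
theorem coeff_freeF_ofFn {n : ℕ} (u : Fin n → Fin l) (g : Fin n → ℕ × Fin l) :
    (freeF 1 u).coeff (List.ofFn g) =
      if Monotone (Prod.fst ∘ g) ∧ u = Prod.snd ∘ g then 1 else 0 := by
  have h : ∀ j : Fin n → ℕ, List.ofFn (fun r => (j ((1 : Equiv.Perm (Fin n)).symm r),
      u ((1 : Equiv.Perm (Fin n)).symm r))) = List.ofFn g ↔
      j = Prod.fst ∘ g ∧ u = Prod.snd ∘ g := by
    intro j
    rw [List.ofFn_injective.eq_iff]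
    simp only [funext_iff, Prod.ext_iff, Function.comp_apply, forall_and]
    rfl
  simp only [freeF, h]
  split_ifs with hg
  · have : Unique {j : Fin n → ℕ // Monotone j ∧
        (∀ r s : Fin n, r.val + 1 = s.val → (1 : Equiv.Perm (Fin n)) s < (1 : Equiv.Perm (Fin n)) r →
          j r < j s) ∧ j = Prod.fst ∘ g ∧ u = Prod.snd ∘ g} :=
      ⟨⟨⟨Prod.fst ∘ g, hg.1, fun r s hrs hlt => by
        have : s.val < r.val := hlt
        omega, rfl, hg.2⟩⟩, fun j => Subtype.ext j.2.2.2.1⟩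
    rw [Nat.card_unique, Nat.cast_one]
  · rw [Nat.cast_eq_zero, Nat.card_eq_zero]
    exact Or.inl ⟨fun j => hg ⟨j.2.2.2.1 ▸ j.2.1, j.2.2.2.2⟩⟩

theorem coeff_freeF_of_length_ne {n : ℕ} (σ : Equiv.Perm (Fin n)) (u : Fin n → Fin l)
    {w : List (ℕ × Fin l)} (hw : w.length ≠ n) : (freeF σ u).coeff w = 0 := by
  simp only [freeF]
  rw [Nat.cast_eq_zero, Nat.card_eq_zero]
  exact Or.inl ⟨fun j => hw (by rw [← j.2.2.2, List.length_ofFn])⟩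

open Classical in
/-- The complete function `S_n` is the sum of the words of multidegree `n` with weakly increasing
positions. -/
theorem coeff_completeS (n : Fin l → ℕ) (w : List (ℕ × Fin l)) :
    (completeS n).coeff w =
      if (w.map Prod.fst).SortedLE ∧ listDeg (w.map Prod.snd) = n then 1 else 0 := by
  rw [completeS, NCSeries.coeff_sum]
  by_cases hw : w.length = pweight n
  · obtain ⟨g, rfl⟩ : ∃ g : Fin (pweight n) → ℕ × Fin l, List.ofFn g = w := by
      rw [← hw]
      exact ⟨w.get, List.ofFn_get w⟩
    simp only [coeff_freeF_ofFn, List.map_ofFn, List.sortedLE_ofFn_iff, listDeg_ofFn]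
    by_cases hg : Monotone (Prod.fst ∘ g)
    · simp only [hg, true_and]
      -- Only the color word read off from `g` contributes to the sum.
      rw [Finset.sum_ite_eq']
      simp
    · simp [hg]
  · rw [Finset.sum_eq_zero fun u _ => coeff_freeF_of_length_ne _ u hw, if_neg]
    rintro ⟨-, rfl⟩
    rw [pweight_listDeg, List.length_map] at hw
    exact hw rfl

theorem completeS_zero : completeS (0 : Fin l → ℕ) = 1 := by
  classical
  refine NCSeries.ext (funext fun w => ?_)
  rw [coeff_completeS, NCSeries.coeff_one]
  refine if_congr ⟨fun h => ?_, ?_⟩ rfl rfl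
  · have := pweight_listDeg (w.map Prod.snd)
    rw [h.2, List.length_map] at this
    exact List.length_eq_zero_iff.1 (this.symm.trans (by simp [pweight]))
  · rintro rfl
    exact ⟨List.Pairwise.nil.sortedLE, rfl⟩

/-! ### Test words and linear independence of the products `S^I` -/

/-- The word whose consecutive blocks have the given colors, the positions being constant on blocks
and strictly decreasing from block to block. -/
def blockWord : List (List (Fin l)) → List (ℕ × Fin l)
  | [] => []
  | u :: U => u.map (fun c => (U.length, c)) ++ blockWord U

/-- The leading block of `u :: U` sits at position `U.length`, so this bound is what makes later
blocks lie strictly below it. -/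
theorem fst_lt_of_mem_blockWord {U : List (List (Fin l))} {x : ℕ × Fin l}
    (hx : x ∈ blockWord U) : x.1 < U.length := by
  induction U with
  | nil => simp [blockWord] at hx
  | cons u U ih =>
    rw [blockWord, List.mem_append, List.mem_map] at hx
    rcases hx with ⟨c, -, rfl⟩ | hx
    · simp
    · exact (ih hx).trans (by simp)

/-- A longer prefix would contain a letter of `u`, at position `U.length`, followed by a letter of a
later block at a smaller position. -/
theorem le_length_of_sortedLE_take {u : List (Fin l)} {U : List (List (Fin l))} (hu : u ≠ [])
    {r : ℕ} (hr : r ≤ (blockWord (u :: U)).length)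
    (h : (((blockWord (u :: U)).take r).map Prod.fst).SortedLE) : r ≤ u.length := by
  by_contra! hlt
  rw [blockWord, List.length_append, List.length_map] at hr
  rw [blockWord, List.take_append, List.take_of_length_le (by simpa using hlt.le), List.length_map,
    List.map_append] at h
  have h := (List.pairwise_append.1 h.pairwise).2.2
  obtain ⟨c, hc⟩ := List.exists_mem_of_ne_nil u hu
  obtain ⟨x, hx⟩ := List.exists_mem_of_ne_nil ((blockWord U).take (r - u.length)) (by
    intro h0
    have := congrArg List.length h0
    rw [List.length_take, List.length_nil] at this
    omega)
  have h1 := h U.length (List.mem_map.2 ⟨(U.length, c), List.mem_map_of_mem hc, rfl⟩) x.1 (List.mem_map_of_mem hx)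
  have h2 := fst_lt_of_mem_blockWord (List.mem_of_mem_take hx)
  omega

/-- A nonzero coefficient yields a cut of the word into pieces, one for each factor. The piece of
the first factor stays inside the first block, so each factor uses up at most one block. -/
theorem length_le_of_coeff_ne_zero {L : List (Fin l → ℕ)} (hL : ∀ n ∈ L, n ≠ 0)
    {U : List (List (Fin l))} (hU : ∀ u ∈ U, u ≠ [])
    (h : ((L.map completeS).prod).coeff (blockWord U) ≠ 0) :
    U.length ≤ L.length ∧ (U.length = L.length → U.map listDeg = L) := by
  classical
  induction L generalizing U with
  | nil =>
    rw [List.map_nil, List.prod_nil, NCSeries.coeff_one] at h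
    have h : blockWord U = [] := by by_contra h'; exact h (if_neg h')
    cases U with
    | nil => simp
    | cons u U =>
      rw [blockWord, List.append_eq_nil_iff, List.map_eq_nil_iff] at h
      exact absurd h.1 (hU u (by simp))
  | cons n L ih =>
    rw [List.map_cons, List.prod_cons, NCSeries.coeff_mul] at h
    obtain ⟨r, hr, h⟩ := Finset.exists_ne_zero_of_sum_ne_zero h
    have h1 := left_ne_zero_of_mul h
    have h2 := right_ne_zero_of_mul h
    rw [coeff_completeS] at h1
    obtain ⟨hs, hd⟩ := (ite_ne_right_iff.1 h1).1
    have ih := fun {U} => ih (fun n hn => hL n (List.mem_cons_of_mem _ hn)) (U := U)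
    cases U with
    | nil =>
      rw [blockWord, List.take_nil] at hd
      exact absurd hd.symm (hL n (by simp))
    | cons u U =>
      have hle := le_length_of_sortedLE_take (hU u (by simp))
        (Nat.lt_succ_iff.1 (Finset.mem_range.1 hr)) hs
      have hU' : ∀ v ∈ U, v ≠ [] := fun v hv => hU v (List.mem_cons_of_mem _ hv)
      -- Either the first factor takes the whole block `u`, of multidegree `n`, and induction
      -- applies to `U`; or it leaves part of `u` over.
      rcases hle.eq_or_lt with rfl | hlt
      · rw [blockWord, List.drop_left' (by simp)] at h2
        rw [blockWord, List.take_left' (by simp), List.map_map] at hd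
        have hd' : listDeg u = n := by
          rw [← hd]; exact congrArg listDeg (by simp [Function.comp_def])
        have := ih hU' h2
        simp only [List.length_cons, List.map_cons, hd']
        exact ⟨by omega, fun h => by rw [this.2 (by omega)]⟩
      -- The remainder is again a block word with as many blocks as before, but one factor fewer is
      -- available, so the inequality becomes strict.
      · have : (blockWord (u :: U)).drop r = blockWord (u.drop r :: U) := by
          rw [blockWord, blockWord, List.drop_append_of_le_length (by simpa using hle),
            List.map_drop]
        rw [this] at h2
        have := ih (by
          intro v hv
          rcases List.mem_cons.1 hv with rfl | hv
          · rw [Ne, List.drop_eq_nil_iff]; omega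
          · exact hU' v hv) h2
        simp only [List.length_cons] at this ⊢
        exact ⟨by omega, fun h => by omega⟩

theorem coeff_completeS_nonneg (n : Fin l → ℕ) (w : List (ℕ × Fin l)) :
    0 ≤ (completeS n).coeff w := by
  classical
  rw [coeff_completeS]
  split_ifs <;> simp

theorem coeff_prod_nonneg (L : List (Fin l → ℕ)) (w : List (ℕ × Fin l)) :
    0 ≤ ((L.map completeS).prod).coeff w := by
  classical
  induction L generalizing w with
  | nil => rw [List.map_nil, List.prod_nil, NCSeries.coeff_one]; split_ifs <;> simp
  | cons n L ih =>
    rw [List.map_cons, List.prod_cons, NCSeries.coeff_mul]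
    exact Finset.sum_nonneg fun r _ => mul_nonneg (coeff_completeS_nonneg n _) (ih _)

/-- Cutting at the end of each block gives a positive term, and nonnegativity of all coefficients
excludes cancellation. -/
theorem coeff_blockWord_pos (U : List (List (Fin l))) :
    0 < (((U.map listDeg).map completeS).prod).coeff (blockWord U) := by
  classical
  induction U with
  | nil => simp [blockWord, NCSeries.coeff_one]
  | cons u U ih =>
    rw [List.map_cons, List.map_cons, List.prod_cons, NCSeries.coeff_mul]
    refine Finset.sum_pos' (fun r _ => mul_nonneg (coeff_completeS_nonneg _ _)
      (coeff_prod_nonneg _ _)) ⟨u.length, by simp [blockWord], ?_⟩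
    rw [blockWord, List.take_left' (by simp), List.drop_left' (by simp), coeff_completeS, if_pos]
    · simpa using ih
    · refine ⟨?_, ?_⟩
      · rw [List.map_map]
        refine List.Pairwise.sortedLE (List.pairwise_map.2 ?_)
        exact List.pairwise_of_forall fun _ _ => le_rfl
      · rw [List.map_map]
        exact congrArg listDeg (by simp [Function.comp_def])

theorem coe_SProd (I : VComp l) :
    (SProd I : NCSeries (ℕ × Fin l)) = (I.cols.map completeS).prod := by
  rw [SProd, ← Subalgebra.val_apply, map_list_prod, List.map_map]
  rfl

theorem exists_blocks (J : VComp l) :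
    ∃ U : List (List (Fin l)), (∀ u ∈ U, u ≠ []) ∧ U.map listDeg = J.cols := by
  choose f hf using exists_listDeg_eq (l := l)
  have h : (J.cols.map f).map listDeg = J.cols := by
    rw [List.map_map]
    conv_rhs => rw [← List.map_id J.cols]
    exact List.map_congr_left fun n _ => hf n
  refine ⟨J.cols.map f, fun u hu => ?_, h⟩
  rintro rfl
  obtain ⟨n, hn, h0⟩ := List.mem_map.1 hu
  refine J.2 n hn ?_
  rw [← hf n, h0]
  rfl

theorem SProd_linearIndependent : LinearIndependent ℚ (SProd : VComp l → NSym l) := by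
  classical
  refine LinearIndependent.of_comp (NSym l).val.toLinearMap ?_
  rw [linearIndependent_iff']
  intro s a ha
  by_contra! hne
  obtain ⟨I₀, hI₀, hI₀'⟩ := hne
  -- In a nontrivial relation, take a longest `J` with nonzero coefficient. Any `I` of the relation
  -- contributing at the block word of `J` has at least as many columns, hence equally many by
  -- maximality, hence equals `J`.
  obtain ⟨J, hJ, hmax⟩ := (s.filter fun I => a I ≠ 0).exists_max_image VComp.len
    ⟨I₀, Finset.mem_filter.2 ⟨hI₀, hI₀'⟩⟩
  rw [Finset.mem_filter] at hJ
  obtain ⟨U, hU, hUJ⟩ := exists_blocks J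
  have h := congrArg (fun f => NCSeries.coeff f (blockWord U)) ha
  simp only [NCSeries.coeff_sum, NCSeries.coeff_smul, NCSeries.coeff_zero, Function.comp_apply,
    AlgHom.toLinearMap_apply, Subalgebra.val_apply, coe_SProd] at h
  rw [Finset.sum_eq_single J] at h
  · have hpos := coeff_blockWord_pos U
    rw [hUJ] at hpos
    exact (mul_ne_zero hJ.2 hpos.ne') h
  · intro I hI hIJ
    by_contra h0
    have hle := hmax I (Finset.mem_filter.2 ⟨hI, left_ne_zero_of_mul h0⟩)
    have h1 := length_le_of_coeff_ne_zero I.2 hU (right_ne_zero_of_mul h0)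
    have hlen : U.length = J.len := by rw [VComp.len, ← hUJ, List.length_map]
    rw [hlen] at h1
    exact hIJ (VComp.ext ((h1.2 (h1.1.antisymm hle)).symm.trans hUJ))
  · exact fun h => absurd hJ.1 h

/-! ### The basis `S^I` and the duality -/

theorem S_zero : S (0 : Fin l → ℕ) = 1 := Subtype.ext completeS_zero

theorem SProd_empty : SProd (VComp.empty l) = 1 := rfl

theorem SProd_append (I J : VComp l) : SProd (I.append J) = SProd I * SProd J := by
  simp only [SProd, VComp.append, VComp.cols, List.map_append, List.prod_append]

theorem SProd_single (n : Fin l → ℕ) (hn : n ≠ 0) : SProd (VComp.single n hn) = S n := by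
  simp [SProd, VComp.single, VComp.cols]

/-- The span contains the generators and is closed under products by concatenation. The generator
`S_0 = 1` is treated apart, `0` not being an admissible column. -/
theorem span_SProd : ⊤ ≤ Submodule.span ℚ (Set.range (SProd : VComp l → NSym l)) := by
  rintro ⟨x, hx⟩ -
  induction hx using Algebra.adjoin_induction with
  | mem x hx =>
    obtain ⟨n, rfl⟩ := hx
    by_cases hn : n = 0
    · refine Submodule.subset_span ⟨VComp.empty l, ?_⟩
      subst hn
      exact SProd_empty.trans S_zero.symm
    · exact Submodule.subset_span ⟨_, SProd_single n hn⟩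
  | algebraMap r =>
    have h : (1 : NSym l) ∈ Submodule.span ℚ (Set.range (SProd : VComp l → NSym l)) :=
      Submodule.subset_span ⟨VComp.empty l, SProd_empty⟩
    have := Submodule.smul_mem _ r h
    rwa [← Algebra.algebraMap_eq_smul_one] at this
  | add x y hx hy ihx ihy => exact add_mem ihx ihy
  | mul x y hx hy ihx ihy =>
    have := Submodule.mul_mem_mul ihx ihy
    rw [Submodule.span_mul_span] at this
    refine Submodule.span_mono ?_ this
    rintro _ ⟨_, ⟨I, rfl⟩, _, ⟨J, rfl⟩, rfl⟩
    exact ⟨I.append J, SProd_append I J⟩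

/-- The products `S^I` form a basis of the noncommutative symmetric functions. -/
noncomputable def basisS (l : ℕ) : Module.Basis (VComp l) ℚ (NSym l) :=
  Module.Basis.mk SProd_linearIndependent span_SProd

@[simp] theorem basisS_apply (I : VComp l) : basisS l I = SProd I := by
  simp [basisS]

/-- The isomorphism from `NSym` to the graded dual of `QSym` with `S^I(M_J) = δ_{I,J}`. -/
noncomputable def dualityEquiv (l : ℕ) : NSym l ≃ₐ[ℚ] gradedDual (QSym.grade l) :=
  AlgEquiv.ofLinearEquiv ((basisS l).equiv (QSym.basisDual l) (Equiv.refl _))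
    (by
      rw [← SProd_empty, ← QSym.dualM_empty, ← basisS_apply, Module.Basis.equiv_apply,
        Equiv.refl_apply, QSym.basisDual_apply])
    (by
      have h : ∀ I, (basisS l).equiv (QSym.basisDual l) (Equiv.refl _) (SProd I) =
          QSym.dualM I := fun I => by
        rw [← basisS_apply, Module.Basis.equiv_apply, Equiv.refl_apply, QSym.basisDual_apply]
      -- By bilinearity, multiplicativity need only be checked on pairs of basis elements, where
      -- both products are concatenation.
      refine LinearMap.map_mul_iff _ |>.2 ?_
      refine (basisS l).ext fun I => (basisS l).ext fun J => ?_
      simp [h, ← SProd_append, QSym.dualM_mul])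

theorem dualityEquiv_SProd (I : VComp l) : dualityEquiv l (SProd I) = QSym.dualM I := by
  change (basisS l).equiv (QSym.basisDual l) (Equiv.refl _) (SProd I) = _
  rw [← basisS_apply, Module.Basis.equiv_apply, Equiv.refl_apply, QSym.basisDual_apply]

theorem isDuality_iff (θ : NSym l ≃ₐ[ℚ] gradedDual (QSym.grade l)) :
    IsDuality θ ↔ ∀ I, θ (SProd I) = QSym.dualM I := by
  classical
  refine ⟨fun h I => QSym.ext_gradedDual fun J => ?_, fun h I J => ?_⟩
  · rw [h, QSym.dualM_M]
  · rw [h, QSym.dualM_M]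

theorem isDuality_iff_eq (θ : NSym l ≃ₐ[ℚ] gradedDual (QSym.grade l)) :
    IsDuality θ ↔ θ = dualityEquiv l := by
  rw [isDuality_iff]
  refine ⟨fun h => ?_, ?_⟩
  · refine AlgEquiv.toLinearMap_injective ((basisS l).ext fun I => ?_)
    simp only [basisS_apply, AlgEquiv.toLinearMap_apply, h, dualityEquiv_SProd]
  · rintro rfl
    exact dualityEquiv_SProd

/-! ### The even ideal -/

theorem dualityEquiv_S {n : Fin l → ℕ} (hn : n ≠ 0) :
    dualityEquiv l (S n) = dualComponent (QSym.grade l) (QSym.zeta l) n := by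
  rw [← SProd_single n hn, dualityEquiv_SProd, QSym.dualComponent_zeta]

/-- Up to the isomorphism the generators on the two sides differ only by zeros and by the unit `-2`.
-/
theorem comap_kEvenIdeal (k : Fin l → ℕ∞) :
    (QSym.kEvenIdeal l k).comap (dualityEquiv l) =
      TwoSidedIdeal.span
        {x : NSym l | ∃ n : Fin l → ℕ, 0 < n ∧ PLe n k ∧ Odd (pweight n) ∧ x = S n} := by
  -- The scalar `-2 = (-1) - 1` is written as an algebra element so that absorption by the ideal
  -- applies to it.
  have hS : ∀ n : Fin l → ℕ, 0 < n → Odd (pweight n) →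
      dualComponent (QSym.grade l) (bar (QSym.grade l) (QSym.zeta l)) n -
        dualComponent (QSym.grade l) (QSym.zeta l) n = dualityEquiv l (algebraMap ℚ _ (-2) * S n) := by
    intro n hn hodd
    rw [← Algebra.smul_def, map_smul, dualityEquiv_S hn.ne', QSym.dualComponent_bar, hodd.neg_one_pow]
    module
  refine le_antisymm ?_ (TwoSidedIdeal.span_le.2 ?_)
  -- Moving the isomorphism to the other side makes the smaller ideal a span, so that checking its
  -- generators is enough.
  · have h : QSym.kEvenIdeal l k ≤ TwoSidedIdeal.comap (dualityEquiv l).symm (TwoSidedIdeal.span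
        {x : NSym l | ∃ n : Fin l → ℕ, 0 < n ∧ PLe n k ∧ Odd (pweight n) ∧ x = S n}) := by
      refine TwoSidedIdeal.span_le.2 ?_
      rintro _ ⟨n, hnk, rfl⟩
      rw [SetLike.mem_coe, TwoSidedIdeal.mem_comap]
      rcases Nat.even_or_odd (pweight n) with he | ho
      · have h0 : dualComponent (QSym.grade l) (bar (QSym.grade l) (QSym.zeta l)) n -
            dualComponent (QSym.grade l) (QSym.zeta l) n = 0 := by
          rw [QSym.dualComponent_bar, he.neg_one_pow]
          module
        rw [h0, map_zero]
        exact zero_mem _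
      · have hn : 0 < n := by
          refine pos_iff_ne_zero.2 ?_
          rintro rfl
          simp [pweight] at ho
        rw [hS n hn ho, AlgEquiv.symm_apply_apply]
        exact TwoSidedIdeal.mul_mem_left _ _ _ (TwoSidedIdeal.subset_span ⟨n, hn, hnk, ho, rfl⟩)
    intro x hx
    have := h ((TwoSidedIdeal.mem_comap _).1 hx)
    rwa [TwoSidedIdeal.mem_comap, AlgEquiv.symm_apply_apply] at this
  · rintro _ ⟨n, hn, hnk, ho, rfl⟩
    rw [SetLike.mem_coe, TwoSidedIdeal.mem_comap]
    -- The factor `-1/2` inverts the `-2` of `hS`.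
    have h1 : S n = algebraMap ℚ _ (-1 / 2) * (algebraMap ℚ _ (-2) * S n) := by
      rw [← mul_assoc, ← map_mul]
      norm_num
    rw [h1, map_mul, ← hS n hn ho]
    exact TwoSidedIdeal.mul_mem_left _ _ _ (TwoSidedIdeal.subset_span ⟨n, hnk, rfl⟩)

end NSym

theorem theoremT (l : ℕ) (hl : 0 < l) (k : Fin l → ℕ∞) :
    (∃! θ : NSym l ≃ₐ[ℚ] gradedDual (QSym.grade l), NSym.IsDuality θ) ∧
    (∀ θ : NSym l ≃ₐ[ℚ] gradedDual (QSym.grade l), NSym.IsDuality θ →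
      (QSym.kEvenIdeal l k).comap θ =
        TwoSidedIdeal.span
          {x : NSym l | ∃ n : Fin l → ℕ, 0 < n ∧ PLe n k ∧ Odd (pweight n) ∧ x = NSym.S n}) ∧
    QSym.kEvenSub l k =
      Submodule.span ℚ
        {f : QSym l | ∃ I : VComp l,
          (∀ c ∈ I.cols, PLe c k → Even (pweight c)) ∧ f = QSym.M I} := by
  refine ⟨⟨NSym.dualityEquiv l, (NSym.isDuality_iff_eq _).2 rfl,
    fun θ hθ => (NSym.isDuality_iff_eq θ).1 hθ⟩, fun θ hθ => ?_, QSym.kEvenSub_eq_evenSpan k⟩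
  rw [(NSym.isDuality_iff_eq θ).1 hθ]
  exact NSym.comap_kEvenIdeal k
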